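/- **Theorem 4 (regret bound for $K$-external sampling).** Consider a finite two-player zero-sum extensive-form game with chance and with perfect recall: histories are finite sequences of actions, $Z$ is the set of terminal histories, $u_p$ is the payoff of player $p$, and $\Delta$ is the difference between the largest and the smallest payoff. Let $\mathcal I_p$ be the set of information sets at which $p$ acts, $A(I)$ the set of actions at the information set $I$, and $|A|=\max_I |A(I)|$. Perfect recall means that any two histories in the same information set of a player have the same sequence of past information sets and past actions of that player. For a strategy profile $\sigma$, write $\pi^\sigma_{-p}(z)$ for the product of the probabilities, under $\sigma$ and chance, of the steps towards $z$ that are not taken by $p$, and $\pi^\sigma_p(h\to z)$ for the product of the probabilities of $p$'s own steps from $h$ to $z$. Let $K,T\ge 1$. $T$ iterations of $K$-external sampling for player $p$ consist of $TK$ rounds $n=tK+d$ ($0\le t<T$, $0\le d<K$). In round $n$ a profile $\sigma_n$ is played, and a block $Q_n\subseteq Z$ is drawn by selecting one action at each history where chance or the opponent acts and exploring all actions of $p$, so that, conditionally on the past, each $z\in Z$ lies in $Q_n$ with probability $q(z)=\pi^{\sigma_n}_{-p}(z)$. The sampled regrets are $$\tilde r_n(I,a)=\sum_{h\in I}\Big(\sum_{z\in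 Q_n,\,h a\sqsubseteq z}u_p(z)\,\pi_p^{\sigma_n}(ha\to z)-\sum_{z\in Q_n,\,h\sqsubseteq z}u_p(z)\,\pi_p^{\sigma_n}(h\to z)\Big),\qquad \tilde R_n(I,a)=\sum_{m<n}\tilde r_m(I,a).$$ Player $p$ uses regret matching on the sampled regrets of earlier iterations: for $I\in\mathcal I_p$ and $\tilde R^+=\max(\tilde R,0)$, $$\sigma_{tK+d}(I,a)=\frac{\tilde R^+_{tK}(I,a)}{\sum_{b\in A(I)}\tilde R^+_{tK}(I,b)}\quad\text{if the denominator is positive,}$$ and an arbitrary strategy at $I$ otherwise. The arbitrary choices and the opponent's strategies may depend on the past but not on the present or future samples (in particular, the opponent may be running the same algorithm). Then for every $\rho\in(0,1]$, with probability at least $1-\rho$, the average regret $$\bar R_p^{TK}=\frac1{TK}\max_{\sigma_p'}\sum_{n<TK}\big(u_p(\sigma_p',\sigma_{n,-p})-u_p(\sigma_n)\big)$$ satisfies $$\bar R_p^{TK}\le\Big(1+\frac{\sqrt2}{\sqrt{\rho K}}\Big)\,|\mathcal I_p|\,\Delta\,\frac{\sqrt{|A|}}{\sqrt T}.$$ 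-/

import Mathlib

open MeasureTheory ProbabilityTheory
open scoped BigOperators

noncomputable section

namespace ImperfectInfo

/-- The actions available after the history `h` when the set of histories is `H`. -/
def legalActions {Act : Type*} (H : Finset (List Act)) (h : List Act) : Finset Act :=
  H.preimage (fun a => h ++ [a]) (fun _ _ _ _ hab => by simpa using hab)

/-- The non-terminal histories at which player `p` acts. -/
def nodesOf {Act : Type*} [DecidableEq Act] (H : Finset (List Act)) (player : List Act → Option (Fin 2))
    (p : Fin 2) : Finset (List Act) :=
  H.filter fun h => (legalActions H h).Nonempty ∧ player h = some p

/-- A finite two-player zero-sum extensive-form game with imperfect information.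
Histories are finite sequences of actions, the root being the empty sequence. -/
structure Game (Act : Type*) [DecidableEq Act] where
  /-- the finite set of histories -/
  H : Finset (List Act)
  nil_mem : [] ∈ H
  prefix_closed : ∀ h a, h ++ [a] ∈ H → h ∈ H
  /-- who acts at a non-terminal history; `none` is chance -/
  player : List Act → Option (Fin 2)
  /-- the fixed distribution of chance at its nodes -/
  chance : List Act → Act → ℝ
  chance_nonneg : ∀ h a, 0 ≤ chance h a
  chance_sum : ∀ h ∈ H, (legalActions H h).Nonempty → player h = none →
    ∑ a ∈ legalActions H h, chance h a = 1
  /-- the payoffs at the terminal histories -/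
  payoff : Fin 2 → List Act → ℝ
  zero_sum : ∀ z ∈ H, legalActions H z = ∅ → payoff 0 z = - payoff 1 z
  /-- the information sets of each player partition the histories where that player acts -/
  infosets : (p : Fin 2) → Finpartition (nodesOf H player p)
  same_actions : ∀ p, ∀ I ∈ (infosets p).parts, ∀ h ∈ I, ∀ h' ∈ I,
    legalActions H h = legalActions H h'

namespace Game

variable {Act : Type*} [DecidableEq Act] (G : Game Act)

/-- `A(h)`. -/
def actions (h : List Act) : Finset Act := legalActions G.H h

/-- `Z`, the terminal histories. -/
def terminals : Finset (List Act) := G.H.filter fun h => G.actions h = ∅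

/-- `A(I)`, the common set of actions of the histories of the information set `I`. -/
def infosetActions (I : Finset (List Act)) : Finset Act := I.biUnion G.actions

/-- The information set of player `p` that contains `h`. -/
def infosetAt (p : Fin 2) (h : List Act) : Finset (List Act) := (G.infosets p).part h

/-- `|𝓘_p|`. -/
def numInfosets (p : Fin 2) : ℕ := (G.infosets p).parts.card

/-- `|A|`, the largest number of actions at any information set. -/
def maxActions : ℕ :=
  Finset.univ.sup fun q : Fin 2 =>
    (G.infosets q).parts.sup fun I => (G.infosetActions I).card

/-- `Δ`, the largest minus the smallest payoff of `p` over the (finite, non-empty) set of terminal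
histories; the same number for both players, since the game is zero-sum. -/
def payoffRange (p : Fin 2) : ℝ :=
  sSup (G.payoff p '' (G.terminals : Set (List Act))) -
    sInf (G.payoff p '' (G.terminals : Set (List Act)))

/-- The sequence of player `p`'s own information sets and of the actions taken there on the way
to `h`. -/
def ownSequence (p : Fin 2) (h : List Act) : List (Finset (List Act) × Act) :=
  ((List.ofFn fun i : Fin h.length => (h.take i, h.get i)).filter
    fun s => G.player s.1 = some p).map fun s => (G.infosetAt p s.1, s.2)

/-- Perfect recall: a player can tell apart two histories at which his own past information sets
or his own past actions differ. -/
def PerfectRecall : Prop :=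
  ∀ p, ∀ I ∈ (G.infosets p).parts, ∀ h ∈ I, ∀ h' ∈ I, G.ownSequence p h = G.ownSequence p h'

/-- A (behavioral) strategy of player `p`: a probability vector over `A(I)` for every information
set `I` of `p`. (The values of `prob` at other arguments are never used.) -/
structure Strategy (p : Fin 2) where
  prob : Finset (List Act) → Act → ℝ
  nonneg : ∀ I ∈ (G.infosets p).parts, ∀ a ∈ G.infosetActions I, 0 ≤ prob I a
  sum_eq_one : ∀ I ∈ (G.infosets p).parts, ∑ a ∈ G.infosetActions I, prob I a = 1

/-- A strategy profile. -/
abbrev Profile : Type _ := (p : Fin 2) → G.Strategy p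

/-- `σ_{P(h)}(h, a)`: the probability that `a` is played at `h`, chance included. -/
def actProb (σ : G.Profile) (h : List Act) (a : Act) : ℝ :=
  match G.player h with
  | none => G.chance h a
  | some q => (σ q).prob (G.infosetAt q h) a

/-- The product of the weights `w h' a` over the steps `h' · a ⊑ z` with `n ≤ length h'`. -/
def pathProd (w : List Act → Act → ℝ) (n : ℕ) (z : List Act) : ℝ :=
  ∏ i : Fin z.length, if n ≤ (i : ℕ) then w (z.take i) (z.get i) else 1

/-- `π^σ(z)`. -/
def reach (σ : G.Profile) (z : List Act) : ℝ := pathProd (G.actProb σ) 0 z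

/-- `π^σ_{-p}(z)`, the contribution of chance and of the opponent of `p` to `π^σ(z)`. -/
def externalReach (p : Fin 2) (σ : G.Profile) (z : List Act) : ℝ :=
  pathProd (fun h a => if G.player h = some p then 1 else G.actProb σ h a) 0 z

/-- `π^σ_p(h → z)` for a prefix `h` of `z`: the contribution of `p` to the probability of playing
from `h` to `z`. -/
def ownReachFrom (p : Fin 2) (σ : G.Profile) (h z : List Act) : ℝ :=
  pathProd (fun h' a => if G.player h' = some p then G.actProb σ h' a else 1) h.length z

/-- `u_p(σ)`, the expected payoff of `p`. -/
def expectedPayoff (p : Fin 2) (σ : G.Profile) : ℝ :=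
  ∑ z ∈ G.terminals, G.reach σ z * G.payoff p z

/-- The outcome of one external-sampling traversal for the traverser `p`: a single action at every
history where chance or the opponent acts. -/
structure ExternalSample (p : Fin 2) where
  choice : List Act → Act
  legal : ∀ h ∈ G.H, (G.actions h).Nonempty → G.player h ≠ some p → choice h ∈ G.actions h

/-- The sampled block `Q ⊆ Z`: the terminal histories met by a traversal that explores all
actions of `p` and only the sampled action elsewhere. -/
def ExternalSample.block {G : Game Act} {p : Fin 2} (c : G.ExternalSample p) :
    Finset (List Act) :=
  G.terminals.filter fun z =>
    ∀ i : Fin z.length, G.player (z.take i) ≠ some p → z.get i = c.choice (z.take i)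

/-- The sampled counterfactual value `ṽ_p^σ(I | Q) = ∑_{z ∈ Q ∩ Z_I} u_p(z) π_p^σ(z[I] → z)`;
the sum over `z ∈ Z_I` with its prefix `z[I]` is a sum over the pairs `h ⊑ z` with `h ∈ I`. -/
def sampledValue (p : Fin 2) (σ : G.Profile) (Q I : Finset (List Act)) : ℝ :=
  ∑ h ∈ I, ∑ z ∈ Q.filter (fun z => h <+: z), G.payoff p z * G.ownReachFrom p σ h z

/-- The sampled counterfactual value `ṽ_p^σ(I, a | Q)`, where `p` plays `a` at `I` with
probability one. -/
def sampledActionValue (p : Fin 2) (σ : G.Profile) (Q I : Finset (List Act)) (a : Act) : ℝ :=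
  ∑ h ∈ I, ∑ z ∈ Q.filter (fun z => h ++ [a] <+: z),
    G.payoff p z * G.ownReachFrom p σ (h ++ [a]) z

/-- The sampled instantaneous regret `r̃(I, a) = ṽ_p^σ(I, a | Q) - ṽ_p^σ(I | Q)`. -/
def sampledRegret (p : Fin 2) (σ : G.Profile) (Q I : Finset (List Act)) (a : Act) : ℝ :=
  G.sampledActionValue p σ Q I a - G.sampledValue p σ Q I

/-- The cumulative sampled regret `R̃_n(I, a)` over the rounds `0, …, n - 1`, when round `m` is
played with profile `σ m` and samples the block of `c m`. -/
def cumSampledRegret {G : Game Act} {p : Fin 2} (σ : ℕ → G.Profile)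
    (c : ℕ → G.ExternalSample p) (n : ℕ) (I : Finset (List Act)) (a : Act) : ℝ :=
  ∑ m ∈ Finset.range n, G.sampledRegret p (σ m) (c m).block I a

/-- `R_p^n`, the total regret of `p` over the rounds `0, …, n - 1`: the maximum over the strategies
`s` of `p` of the gain from having played `s` throughout. (The gain is bounded in `s`, and the
supremum is attained.) -/
def totalRegret (p : Fin 2) (σ : ℕ → G.Profile) (n : ℕ) : ℝ :=
  ⨆ s : G.Strategy p, ∑ m ∈ Finset.range n,
    (G.expectedPayoff p (Function.update (σ m) p s) - G.expectedPayoff p (σ m))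

/-- A run of `K`-external sampling for the traverser `p`. Traversal `d < K` of iteration `t` is
round `t * K + d`. The opponent's strategies are only required not to depend on the present and
future samples; so his strategy may come from his own simultaneous or alternating updates. -/
structure KESRun {Ω : Type*} [m : MeasurableSpace Ω] (G : Game Act) (p : Fin 2) (K : ℕ)
    (μ : Measure Ω) where
  /-- what is known before each round -/
  ℱ : Filtration ℕ m
  /-- the strategy profile played in each round -/
  σ : ℕ → Ω → G.Profile
  /-- the sample drawn in each round -/
  sample : ℕ → Ω → G.ExternalSample p
  strategy_measurable : ∀ n q, ∀ I ∈ (G.infosets q).parts, ∀ a ∈ G.infosetActions I,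
    Measurable[ℱ n] fun ω => (σ n ω q).prob I a
  block_measurable : ∀ n, ∀ z ∈ G.terminals, MeasurableSet[ℱ (n + 1)]
    {ω | z ∈ (sample n ω).block}
  /-- given the past, `z` is sampled with probability `q(z) = π^σ_{-p}(z)` -/
  sample_law : ∀ n, ∀ z ∈ G.terminals,
    μ⟦{ω | z ∈ (sample n ω).block} | ℱ n⟧ =ᵐ[μ] fun ω => G.externalReach p (σ n ω) z
  /-- in all rounds of iteration `t`, `p` plays regret matching on the sampled regrets of the
  iterations before `t`, and an arbitrary strategy at `I` if no regret is positive there -/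
  regret_matching : ∀ t d, d < K → ∀ ω, ∀ I ∈ (G.infosets p).parts,
    0 < ∑ b ∈ G.infosetActions I,
      max (cumSampledRegret (fun k => σ k ω) (fun k => sample k ω) (t * K) I b) 0 →
    ∀ a ∈ G.infosetActions I, (σ (t * K + d) ω p).prob I a =
      max (cumSampledRegret (fun k => σ k ω) (fun k => sample k ω) (t * K) I a) 0 /
        ∑ b ∈ G.infosetActions I,
          max (cumSampledRegret (fun k => σ k ω) (fun k => sample k ω) (t * K) I b) 0

/-- The average regret of `p` after `T` iterations, that is, over the first `T * K` rounds. -/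
def KESRun.avgRegret {Ω : Type*} [MeasurableSpace Ω] {G : Game Act} {p : Fin 2} {K : ℕ}
    {μ : Measure Ω} (X : KESRun G p K μ) (T : ℕ) (ω : Ω) : ℝ :=
  G.totalRegret p (fun n => X.σ n ω) (T * K) / ((T : ℝ) * K)

end Game

end ImperfectInfo

end

open MeasureTheory ProbabilityTheory
open scoped BigOperators

noncomputable section

namespace ImperfectInfo

namespace Game

/-! ### Products of step weights along a history. -/

section PathProd

variable {Act : Type*}

/-! The bound splits the true regret into the sampled regret, which regret matching controls on
every path, and a martingale deviation, which is small with high probability.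

Reduction to information sets: replacing `p`'s strategy by a fixed one changes the payoff by a sum
of local differences over `p`'s histories, weighted by the new strategy's own reach. Perfect recall
makes this reach constant on each information set, so the total regret is at most a sum of bounds on
the immediate counterfactual regrets (`expectedPayoff_update_sub`, `totalRegret_le`).

Boundedness: under perfect recall one traversal meets at most one history of an information set, and
the sampled value there is a convex combination of payoffs. Hence one round's sampled regret is at
most `Δ` in absolute value (`abs_sampledRegret_le`), without any importance weights.

Sampled part: the `K` rounds of an iteration act as one regret-matching step of size at most `K Δ`,
and Blackwell's potential bounds the squared positive regrets at `I` by `T |A(I)| (K Δ)^2`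
(`sum_sq_max_sampled_le`).

Deviation: the sampled regret has the counterfactual regret as its conditional mean
(`condExp_sampled`). Orthogonality of martingale increments gives second moment at most `T K Δ^2`
for each pair `(I, a)`. Markov's inequality is applied once, to the sum over all pairs, and
Cauchy-Schwarz over information sets converts this into a bound linear in their number. -/

lemma pathProd_of_length_le (w : List Act → Act → ℝ) {n : ℕ} {z : List Act} (h : z.length ≤ n) :
    pathProd w n z = 1 := by
  unfold pathProd
  refine Finset.prod_eq_one fun i _ => if_neg ?_
  have := i.2
  omega

lemma pathProd_step (w : List Act → Act → ℝ) {n : ℕ} {z : List Act} (h : n < z.length) :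
    pathProd w n z = w (z.take n) (z.get ⟨n, h⟩) * pathProd w (n + 1) z := by
  unfold pathProd
  have key : ∀ i : Fin z.length, (if n ≤ (i : ℕ) then w (z.take i) (z.get i) else 1) =
      (if i = ⟨n, h⟩ then w (z.take i) (z.get i) else 1) *
        (if n + 1 ≤ (i : ℕ) then w (z.take i) (z.get i) else 1) := by
    intro i
    by_cases hi : i = ⟨n, h⟩
    · subst hi; simp
    · have : (i : ℕ) ≠ n := fun e => hi (Fin.ext e)
      by_cases h2 : n ≤ (i : ℕ)
      · have h3 : n + 1 ≤ (i : ℕ) := by omega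
        simp [hi, h2, h3]
      · have h3 : ¬ n + 1 ≤ (i : ℕ) := by omega
        simp [hi, h2, h3]
  rw [Finset.prod_congr rfl fun i _ => key i, Finset.prod_mul_distrib,
    Finset.prod_ite_eq' Finset.univ]
  simp

lemma pathProd_of_prefix (w : List Act → Act → ℝ) {h z : List Act} {a : Act}
    (hz : h ++ [a] <+: z) :
    pathProd w h.length z = w h a * pathProd w (h ++ [a]).length z := by
  obtain ⟨t, rfl⟩ := hz
  rw [pathProd_step w (by simp)]
  simp

lemma pathProd_append_singleton (w : List Act → Act → ℝ) (h : List Act) (a : Act) :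
    pathProd w 0 (h ++ [a]) = pathProd w 0 h * w h a := by
  unfold pathProd
  have e : (h ++ [a]).length = h.length + 1 := by simp
  rw [← Fintype.prod_equiv (finCongr e.symm)
    (fun i : Fin (h.length + 1) => w ((h ++ [a]).take i) ((h ++ [a]).get (finCongr e.symm i))) _
    (fun i => by simp), Fin.prod_univ_castSucc]
  simp [List.take_append_of_le_length, List.getElem_append_left]

lemma pathProd_mul (w w' : List Act → Act → ℝ) (n : ℕ) (z : List Act) :
    pathProd w n z * pathProd w' n z = pathProd (fun h a => w h a * w' h a) n z := by
  unfold pathProd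
  rw [← Finset.prod_mul_distrib]
  refine Finset.prod_congr rfl fun i _ => ?_
  split_ifs <;> simp

lemma pathProd_mem_Icc {w : List Act → Act → ℝ} {z : List Act}
    (hw : ∀ h a, h ++ [a] <+: z → w h a ∈ Set.Icc (0 : ℝ) 1) (n : ℕ) :
    pathProd w n z ∈ Set.Icc (0 : ℝ) 1 := by
  have key : ∀ i : Fin z.length,
      (if n ≤ (i : ℕ) then w (z.take i) (z.get i) else 1) ∈ Set.Icc (0 : ℝ) 1 := by
    intro i
    split_ifs
    · refine hw _ _ ?_
      rw [List.get_eq_getElem, List.take_append_getElem]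
      exact List.take_prefix _ _
    · simp
  exact ⟨Finset.prod_nonneg fun i _ => (key i).1,
    Finset.prod_le_one (fun i _ => (key i).1) fun i _ => (key i).2⟩

lemma measurable_pathProd {Ω : Type*} {m : MeasurableSpace Ω} {w : Ω → List Act → Act → ℝ}
    {z : List Act} (hw : ∀ h a, h ++ [a] <+: z → Measurable[m] fun ω => w ω h a) (n : ℕ) :
    Measurable[m] fun ω => pathProd (w ω) n z := by
  unfold pathProd
  refine Finset.measurable_prod _ fun i _ => ?_
  split_ifs
  · refine hw _ _ ?_
    rw [List.get_eq_getElem, List.take_append_getElem]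
    exact List.take_prefix _ _
  · exact measurable_const

lemma eq_of_append_singleton_prefix {h z : List Act} {a b : Act} (ha : h ++ [a] <+: z)
    (hb : h ++ [b] <+: z) : a = b := by
  obtain ⟨s, rfl⟩ := ha
  obtain ⟨t, ht⟩ := hb
  simp only [List.append_assoc, List.append_cancel_left_eq, List.singleton_append,
    List.cons.injEq] at ht
  exact ht.1.symm

end PathProd

variable {Act : Type*} [DecidableEq Act] (G : Game Act)

/-! ### Continuation values on the game tree and the performance difference identity. -/

section Tree

lemma mem_actions {h : List Act} {a : Act} : a ∈ G.actions h ↔ h ++ [a] ∈ G.H :=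
  Finset.mem_preimage (f := fun a => h ++ [a]) (hf := fun _ _ _ _ hab => by simpa using hab)

lemma mem_H_of_prefix {h z : List Act} (hz : z ∈ G.H) (hp : h <+: z) : h ∈ G.H := by
  obtain ⟨t, rfl⟩ := hp
  induction t using List.reverseRecOn with
  | nil => simpa using hz
  | append_singleton t a ih =>
    rw [← List.append_assoc] at hz
    exact ih (G.prefix_closed _ _ hz)

lemma mem_terminals {z : List Act} : z ∈ G.terminals ↔ z ∈ G.H ∧ G.actions z = ∅ := by
  simp [terminals]

/-- The non-terminal histories. -/
def internals : Finset (List Act) := G.H.filter fun h => (G.actions h).Nonempty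

lemma mem_internals {h : List Act} : h ∈ G.internals ↔ h ∈ G.H ∧ (G.actions h).Nonempty := by
  simp [internals]

lemma mem_nodesOf {p : Fin 2} {h : List Act} :
    h ∈ nodesOf G.H G.player p ↔ h ∈ G.internals ∧ G.player h = some p := by
  rw [mem_internals, and_assoc]
  exact Finset.mem_filter

lemma mem_internals_of_mem_actions {h : List Act} {a : Act} (ha : a ∈ G.actions h) :
    h ∈ G.internals :=
  G.mem_internals.2 ⟨G.prefix_closed _ _ (G.mem_actions.1 ha), ⟨a, ha⟩⟩

lemma mem_actions_of_prefix {h z : List Act} {a : Act} (hz : z ∈ G.H) (hp : h ++ [a] <+: z) :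
    a ∈ G.actions h :=
  G.mem_actions.2 (G.mem_H_of_prefix hz hp)

lemma exists_terminal_extension {h : List Act} (hh : h ∈ G.H) : ∃ z ∈ G.terminals, h <+: z := by
  obtain ⟨z, hz, hmax⟩ := (G.H.filter fun z => h <+: z).exists_max_image List.length
    ⟨h, by simp [hh]⟩
  simp only [Finset.mem_filter] at hz hmax
  refine ⟨z, G.mem_terminals.2 ⟨hz.1, ?_⟩, hz.2⟩
  by_contra hne
  obtain ⟨a, ha⟩ := Finset.nonempty_iff_ne_empty.2 hne
  have := hmax (z ++ [a]) ⟨G.mem_actions.1 ha, hz.2.trans (List.prefix_append _ _)⟩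
  simp at this

lemma terminals_nonempty : G.terminals.Nonempty := by
  obtain ⟨z, hz, -⟩ := G.exists_terminal_extension G.nil_mem
  exact ⟨z, hz⟩

lemma exists_action_prefix {h z : List Act} (hh : h ∈ G.internals) (hz : z ∈ G.terminals)
    (hp : h <+: z) : ∃ a ∈ G.actions h, h ++ [a] <+: z := by
  obtain ⟨t, rfl⟩ := hp
  cases t with
  | nil =>
    rw [List.append_nil] at hz
    exact absurd (G.mem_terminals.1 hz).2 (G.mem_internals.1 hh).2.ne_empty
  | cons a t =>
    have hp : h ++ [a] <+: h ++ a :: t := ⟨t, by simp⟩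
    exact ⟨a, G.mem_actions_of_prefix (G.mem_terminals.1 hz).1 hp, hp⟩

lemma eq_of_terminal_prefix {z z' : List Act} (hz : z ∈ G.terminals) (hz' : z' ∈ G.terminals)
    (hp : z <+: z') : z' = z := by
  obtain ⟨t, rfl⟩ := hp
  cases t with
  | nil => simp
  | cons a t =>
    have ha := G.mem_actions_of_prefix (G.mem_terminals.1 hz').1
      (show z ++ [a] <+: z ++ a :: t from ⟨t, by simp⟩)
    rw [(G.mem_terminals.1 hz).2] at ha
    simp at ha

/-- The value of continuing from `h` with weights `W` on the steps when the terminal history `z`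
is worth `w z`. -/
def contValue (W : List Act → Act → ℝ) (w : List Act → ℝ) (h : List Act) : ℝ :=
  ∑ z ∈ G.terminals.filter (fun z => h <+: z), w z * pathProd W h.length z

lemma contValue_terminal (W : List Act → Act → ℝ) (w : List Act → ℝ) {z : List Act}
    (hz : z ∈ G.terminals) : G.contValue W w z = w z := by
  have : G.terminals.filter (fun z' => z <+: z') = {z} := by
    ext z'
    simp only [Finset.mem_filter, Finset.mem_singleton]
    exact ⟨fun h => G.eq_of_terminal_prefix hz h.1 h.2, fun h => by subst h; exact ⟨hz, List.prefix_rfl⟩⟩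
  rw [contValue, this, Finset.sum_singleton, pathProd_of_length_le W le_rfl, mul_one]

lemma contValue_internal (W : List Act → Act → ℝ) (w : List Act → ℝ) {h : List Act}
    (hh : h ∈ G.internals) :
    G.contValue W w h = ∑ a ∈ G.actions h, W h a * G.contValue W w (h ++ [a]) := by
  have e : G.terminals.filter (fun z => h <+: z) =
      (G.actions h).biUnion fun a => G.terminals.filter fun z => h ++ [a] <+: z := by
    ext z
    simp only [Finset.mem_filter, Finset.mem_biUnion]
    constructor
    · rintro ⟨hz, hp⟩
      obtain ⟨a, ha, hp⟩ := G.exists_action_prefix hh hz hp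
      exact ⟨a, ha, hz, hp⟩
    · rintro ⟨a, -, hz, hp⟩
      exact ⟨hz, (List.prefix_append _ _).trans hp⟩
  unfold contValue
  rw [e, Finset.sum_biUnion]
  · refine Finset.sum_congr rfl fun a _ => ?_
    rw [Finset.mul_sum]
    refine Finset.sum_congr rfl fun z hz => ?_
    rw [pathProd_of_prefix W (Finset.mem_filter.1 hz).2]
    ring
  · intro a _ b _ hab
    refine Finset.disjoint_left.2 fun z hz hz' => hab ?_
    exact eq_of_append_singleton_prefix (Finset.mem_filter.1 hz).2 (Finset.mem_filter.1 hz').2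

/-- Every history but the root is a child of exactly one history. This supplies the telescoping in
`contValue_nil_sub`. -/
lemma sum_internals_actions (f : List Act → ℝ) :
    ∑ h ∈ G.internals, ∑ a ∈ G.actions h, f (h ++ [a]) = ∑ h ∈ G.H.erase [], f h := by
  rw [Finset.sum_sigma']
  refine Finset.sum_bij (fun x _ => x.1 ++ [x.2]) ?_ ?_ ?_ ?_
  · rintro ⟨h, a⟩ hx
    simp only [Finset.mem_sigma] at hx
    simpa using G.mem_actions.1 hx.2
  · rintro ⟨h, a⟩ _ ⟨h', a'⟩ _ e
    obtain ⟨rfl, e2⟩ := List.append_inj' e rfl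
    simp_all
  · intro h hh
    simp only [Finset.mem_erase] at hh
    induction h using List.reverseRecOn with
    | nil => exact absurd rfl hh.1
    | append_singleton h a _ =>
      have ha := G.mem_actions.2 hh.2
      exact ⟨⟨h, a⟩, Finset.mem_sigma.2 ⟨G.mem_internals_of_mem_actions ha, ha⟩, rfl⟩
  · intros; rfl

lemma sum_internals_add_sum_terminals (f : List Act → ℝ) :
    ∑ h ∈ G.internals, f h + ∑ z ∈ G.terminals, f z = ∑ h ∈ G.H, f h := by
  rw [← Finset.sum_filter_add_sum_filter_not G.H (fun h => (G.actions h).Nonempty)]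
  simp [internals, terminals, Finset.not_nonempty_iff_eq_empty]

/-- The performance difference identity. -/
lemma contValue_nil_sub (W W' : List Act → Act → ℝ) (w : List Act → ℝ) :
    G.contValue W' w [] - G.contValue W w [] =
      ∑ h ∈ G.internals, pathProd W' 0 h *
        (∑ a ∈ G.actions h, W' h a * G.contValue W w (h ++ [a]) - G.contValue W w h) := by
  -- Put `f h` for the reach under `W'` times the value under `W`. The right-hand side is the sum of
  -- `f` over all children minus its sum over internal histories; this telescopes to the terminal
  -- sum minus `f []`.
  have h1 := G.sum_internals_actions fun h => pathProd W' 0 h * G.contValue W w h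
  have h2 := G.sum_internals_add_sum_terminals fun h => pathProd W' 0 h * G.contValue W w h
  have h3 := Finset.sum_erase_add G.H (fun h => pathProd W' 0 h * G.contValue W w h) G.nil_mem
  have h4 : ∑ z ∈ G.terminals, pathProd W' 0 z * G.contValue W w z = G.contValue W' w [] := by
    unfold contValue
    simp only [List.nil_prefix, Finset.filter_true, List.length_nil]
    refine Finset.sum_congr rfl fun z hz => ?_
    have := G.contValue_terminal W w hz
    unfold contValue at this
    rw [this, mul_comm]
  have h5 : pathProd W' 0 ([] : List Act) = 1 := pathProd_of_length_le _ le_rfl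
  simp only [mul_sub, Finset.sum_sub_distrib, Finset.mul_sum]
  have h6 : ∑ h ∈ G.internals, ∑ a ∈ G.actions h,
        pathProd W' 0 h * (W' h a * G.contValue W w (h ++ [a])) =
      ∑ h ∈ G.internals, ∑ a ∈ G.actions h,
        pathProd W' 0 (h ++ [a]) * G.contValue W w (h ++ [a]) := by
    refine Finset.sum_congr rfl fun h _ => Finset.sum_congr rfl fun a _ => ?_
    rw [pathProd_append_singleton, mul_assoc]
  rw [h6]
  simp only [h4, h5] at h1 h2 h3
  linarith

end Tree

/-! ### Information sets, perfect recall and the reduction to counterfactual regret. -/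

section Infosets

variable {G} {p : Fin 2}

lemma mem_nodesOf_of_mem_infoset {I : Finset (List Act)} (hI : I ∈ (G.infosets p).parts)
    {h : List Act} (hh : h ∈ I) : h ∈ G.internals ∧ G.player h = some p :=
  G.mem_nodesOf.1 ((G.infosets p).le hI hh)

lemma infosetAt_eq {I : Finset (List Act)} (hI : I ∈ (G.infosets p).parts)
    {h : List Act} (hh : h ∈ I) : G.infosetAt p h = I :=
  (G.infosets p).part_eq_of_mem hI hh

lemma infosetAt_mem_parts {h : List Act} (hh : h ∈ G.internals) (hp : G.player h = some p) :
    G.infosetAt p h ∈ (G.infosets p).parts :=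
  (G.infosets p).part_mem.2 (G.mem_nodesOf.2 ⟨hh, hp⟩)

lemma mem_infosetAt {h : List Act} (hh : h ∈ G.internals) (hp : G.player h = some p) :
    h ∈ G.infosetAt p h :=
  (G.infosets p).mem_part (G.mem_nodesOf.2 ⟨hh, hp⟩)

lemma infosetActions_eq {I : Finset (List Act)} (hI : I ∈ (G.infosets p).parts)
    {h : List Act} (hh : h ∈ I) : G.infosetActions I = G.actions h := by
  ext a
  simp only [infosetActions, Finset.mem_biUnion]
  constructor
  · rintro ⟨h', hh', ha⟩
    have := G.same_actions p I hI h' hh' h hh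
    unfold actions at *
    rwa [← this]
  · exact fun ha => ⟨h, hh, ha⟩

lemma infoset_nonempty {I : Finset (List Act)} (hI : I ∈ (G.infosets p).parts) : I.Nonempty :=
  (G.infosets p).nonempty_of_mem_parts hI

lemma card_infosetActions_le {I : Finset (List Act)} (hI : I ∈ (G.infosets p).parts) :
    (G.infosetActions I).card ≤ G.maxActions := by
  refine le_trans ?_ (Finset.le_sup (f := fun q : Fin 2 =>
    (G.infosets q).parts.sup fun I => (G.infosetActions I).card) (Finset.mem_univ p))
  exact Finset.le_sup (f := fun I => (G.infosetActions I).card) hI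

lemma sum_nodesOf (f : List Act → ℝ) :
    ∑ h ∈ nodesOf G.H G.player p, f h = ∑ I ∈ (G.infosets p).parts, ∑ h ∈ I, f h := by
  have h := Finset.sum_biUnion (f := f) (s := (G.infosets p).parts) (t := id)
    (G.infosets p).disjoint
  have e : (G.infosets p).parts.biUnion id = nodesOf G.H G.player p := (G.infosets p).biUnion_parts
  rw [e] at h
  exact h

/-- The weight that a strategy of `p` puts on the steps, with weight one on the steps of others. -/
def ownWeight (s : G.Strategy p) (h : List Act) (a : Act) : ℝ :=
  if G.player h = some p then s.prob (G.infosetAt p h) a else 1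

lemma ownWeight_of_player {s : G.Strategy p} {h : List Act} (hp : G.player h = some p) (a : Act) :
    ownWeight s h a = s.prob (G.infosetAt p h) a := if_pos hp

lemma ownWeight_of_not_player {s : G.Strategy p} {h : List Act} (hp : G.player h ≠ some p)
    (a : Act) : ownWeight s h a = 1 := if_neg hp

lemma ownWeight_of_mem {s : G.Strategy p} {I : Finset (List Act)}
    (hI : I ∈ (G.infosets p).parts) {h : List Act} (hh : h ∈ I) (a : Act) :
    ownWeight s h a = s.prob I a := by
  rw [ownWeight_of_player (mem_nodesOf_of_mem_infoset hI hh).2, infosetAt_eq hI hh]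

lemma sum_ownWeight (s : G.Strategy p) {h : List Act} (hh : h ∈ G.internals)
    (hp : G.player h = some p) : ∑ a ∈ G.actions h, ownWeight s h a = 1 := by
  have hI := infosetAt_mem_parts hh hp
  rw [← s.sum_eq_one _ hI, infosetActions_eq hI (mem_infosetAt hh hp)]
  exact Finset.sum_congr rfl fun a _ => ownWeight_of_player hp a

lemma ownWeight_nonneg (s : G.Strategy p) {h : List Act} {a : Act} (ha : a ∈ G.actions h) :
    0 ≤ ownWeight s h a := by
  by_cases hp : G.player h = some p
  · have hh := G.mem_internals_of_mem_actions ha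
    have hI := infosetAt_mem_parts hh hp
    rw [ownWeight_of_player hp]
    exact s.nonneg _ hI _ (by rwa [infosetActions_eq hI (mem_infosetAt hh hp)])
  · rw [ownWeight_of_not_player hp]
    exact zero_le_one

lemma ownWeight_mem_Icc (s : G.Strategy p) {h : List Act} {a : Act} (ha : a ∈ G.actions h) :
    ownWeight s h a ∈ Set.Icc (0 : ℝ) 1 := by
  refine ⟨ownWeight_nonneg s ha, ?_⟩
  by_cases hp : G.player h = some p
  · rw [← sum_ownWeight s (G.mem_internals_of_mem_actions ha) hp]
    exact Finset.single_le_sum (f := fun b => ownWeight s h b)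
      (fun b hb => ownWeight_nonneg s hb) ha
  · rw [ownWeight_of_not_player hp]

variable (G) in
lemma actProb_eq_ownWeight (σ : G.Profile) {h : List Act} (hp : G.player h = some p) (a : Act) :
    G.actProb σ h a = ownWeight (σ p) h a := by
  rw [ownWeight_of_player hp, actProb, hp]

lemma actProb_mem_Icc (σ : G.Profile) {h : List Act} {a : Act} (ha : a ∈ G.actions h) :
    G.actProb σ h a ∈ Set.Icc (0 : ℝ) 1 := by
  have hh := G.mem_internals_of_mem_actions ha
  rcases hq : G.player h with _ | q
  · have e : G.actProb σ h a = G.chance h a := by rw [actProb, hq]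
    rw [e]
    refine ⟨G.chance_nonneg h a, ?_⟩
    rw [← G.chance_sum h (G.mem_internals.1 hh).1 (G.mem_internals.1 hh).2 hq]
    exact Finset.single_le_sum (f := fun b => G.chance h b)
      (fun b _ => G.chance_nonneg h b) ha
  · rw [actProb_eq_ownWeight G σ hq]
    exact ownWeight_mem_Icc _ ha

variable (G) in
lemma externalReach_mem_Icc (σ : G.Profile) {z : List Act} (hz : z ∈ G.terminals) :
    G.externalReach p σ z ∈ Set.Icc (0 : ℝ) 1 := by
  refine pathProd_mem_Icc (fun h a hp => ?_) 0
  split_ifs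
  · simp
  · exact actProb_mem_Icc σ (G.mem_actions_of_prefix (G.mem_terminals.1 hz).1 hp)

variable (G) in
lemma ownReachFrom_eq (σ : G.Profile) (h z : List Act) :
    G.ownReachFrom p σ h z = pathProd (ownWeight (σ p)) h.length z := by
  unfold ownReachFrom
  congr 1
  funext h' a
  split_ifs with hp
  · exact actProb_eq_ownWeight G σ hp a
  · exact (ownWeight_of_not_player hp a).symm

variable (G) in
lemma reach_eq (σ : G.Profile) (z : List Act) :
    G.reach σ z = G.externalReach p σ z * pathProd (ownWeight (σ p)) 0 z := by
  unfold reach externalReach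
  rw [pathProd_mul]
  congr 1
  funext h a
  split_ifs with hp
  · rw [one_mul, actProb_eq_ownWeight G σ hp a]
  · rw [ownWeight_of_not_player hp, mul_one]

variable (G) in
lemma externalReach_update (σ : G.Profile) (s : G.Strategy p) (z : List Act) :
    G.externalReach p (Function.update σ p s) z = G.externalReach p σ z := by
  unfold externalReach
  congr 1
  funext h a
  split_ifs with hp
  · rfl
  · rcases hq : G.player h with _ | q
    · simp only [actProb, hq]
    · have : q ≠ p := fun e => hp (by rw [hq, e])
      simp only [actProb, hq, Function.update_of_ne this]

variable (p) in
/-- The terminal payoffs of `p` weighted by the external reach. -/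
def externalPayoff (σ : G.Profile) (z : List Act) : ℝ := G.externalReach p σ z * G.payoff p z

variable (G) in
lemma expectedPayoff_eq (σ : G.Profile) :
    G.expectedPayoff p σ = G.contValue (ownWeight (σ p)) (externalPayoff p σ) [] := by
  unfold expectedPayoff contValue externalPayoff
  simp only [List.nil_prefix, Finset.filter_true, List.length_nil]
  refine Finset.sum_congr rfl fun z _ => ?_
  rw [reach_eq G σ z (p := p)]
  ring

lemma contValue_of_not_player (s : G.Strategy p) (w : List Act → ℝ) {h : List Act}
    (hh : h ∈ G.internals) (hp : G.player h ≠ some p) :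
    G.contValue (ownWeight s) w h = ∑ a ∈ G.actions h, G.contValue (ownWeight s) w (h ++ [a]) := by
  rw [G.contValue_internal _ _ hh]
  exact Finset.sum_congr rfl fun a _ => by rw [ownWeight_of_not_player hp, one_mul]

variable (G) in
/-- The counterfactual regret at `I` for not having played `a`, for the steps weights `W` and the
terminal weights `w`. -/
def cfRegret (W : List Act → Act → ℝ) (w : List Act → ℝ) (I : Finset (List Act)) (a : Act) : ℝ :=
  ∑ h ∈ I, (G.contValue W w (h ++ [a]) - G.contValue W w h)

/-- A strategy does not regret its own mixture of actions. -/
lemma sum_prob_mul_cfRegret (s : G.Strategy p) (w : List Act → ℝ) {I : Finset (List Act)}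
    (hI : I ∈ (G.infosets p).parts) :
    ∑ a ∈ G.infosetActions I, s.prob I a * G.cfRegret (ownWeight s) w I a = 0 := by
  simp only [cfRegret, Finset.mul_sum]
  rw [Finset.sum_comm]
  refine Finset.sum_eq_zero fun h hh => ?_
  simp only [mul_sub, Finset.sum_sub_distrib, ← Finset.sum_mul]
  rw [s.sum_eq_one I hI, one_mul, G.contValue_internal _ _ (mem_nodesOf_of_mem_infoset hI hh).1,
    infosetActions_eq hI hh, sub_eq_zero]
  exact Finset.sum_congr rfl fun a _ => by rw [ownWeight_of_mem hI hh]

variable (G) in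
lemma ownSequence_append_singleton (p : Fin 2) (h : List Act) (a : Act) :
    G.ownSequence p (h ++ [a]) = G.ownSequence p h ++
      (if G.player h = some p then [(G.infosetAt p h, a)] else []) := by
  unfold ownSequence
  have e : (List.ofFn fun i : Fin (h ++ [a]).length => ((h ++ [a]).take i, (h ++ [a]).get i)) =
      (List.ofFn fun i : Fin h.length => (h.take i, h.get i)) ++ [(h, a)] := by
    refine List.ext_getElem (by simp) fun i h1 h2 => ?_
    simp only [List.length_ofFn, List.length_append, List.length_singleton] at h1
    rw [List.getElem_ofFn]
    rcases Nat.lt_or_ge i h.length with hi | hi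
    · rw [List.getElem_append_left (by simpa using hi), List.getElem_ofFn]
      simp [List.take_append_of_le_length hi.le, hi]
    · obtain rfl : i = h.length := by omega
      simp
  rw [e, List.filter_append, List.map_append]
  congr 1
  by_cases hp : G.player h = some p <;> simp [hp]

variable (G) in
lemma ownSequence_prefix (p : Fin 2) {h z : List Act} (hp : h <+: z) :
    G.ownSequence p h <+: G.ownSequence p z := by
  obtain ⟨t, rfl⟩ := hp
  induction t using List.reverseRecOn with
  | nil => simp
  | append_singleton t a ih =>
    rw [← List.append_assoc, ownSequence_append_singleton]
    exact ih.trans (List.prefix_append _ _)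

/-- The own reach sees a history only through the player's own sequence, which is exactly what
perfect recall equates within an information set. -/
lemma pathProd_ownWeight_eq (s : G.Strategy p) (h : List Act) :
    pathProd (ownWeight s) 0 h = ((G.ownSequence p h).map fun x => s.prob x.1 x.2).prod := by
  induction h using List.reverseRecOn with
  | nil => simp [pathProd, ownSequence]
  | append_singleton h a ih =>
    rw [pathProd_append_singleton, ownSequence_append_singleton, List.map_append, List.prod_append,
      ih]
    congr 1
    by_cases hp : G.player h = some p
    · simp [hp, ownWeight_of_player hp]
    · simp [hp, ownWeight_of_not_player hp]

lemma exists_infoset_reach (hG : G.PerfectRecall) (s : G.Strategy p) {I : Finset (List Act)}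
    (hI : I ∈ (G.infosets p).parts) :
    ∃ c ∈ Set.Icc (0 : ℝ) 1, ∀ h ∈ I, pathProd (ownWeight s) 0 h = c := by
  obtain ⟨h, hh⟩ := infoset_nonempty hI
  have hH := (G.mem_internals.1 (mem_nodesOf_of_mem_infoset hI hh).1).1
  refine ⟨pathProd (ownWeight s) 0 h, pathProd_mem_Icc (fun g a hp =>
    ownWeight_mem_Icc s (G.mem_actions_of_prefix hH hp)) 0, fun h' hh' => ?_⟩
  rw [pathProd_ownWeight_eq, pathProd_ownWeight_eq, hG p I hI h' hh' h hh]

/-- Both profiles have the same external reach, so they differ only in `p`'s weights for common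
terminal weights, and the performance difference identity applies. At histories where `p` does not
act both weights are one and the local difference vanishes. -/
lemma expectedPayoff_update_sub (σ : G.Profile) (s : G.Strategy p) :
    G.expectedPayoff p (Function.update σ p s) - G.expectedPayoff p σ =
      ∑ I ∈ (G.infosets p).parts, ∑ h ∈ I, pathProd (ownWeight s) 0 h *
        ∑ a ∈ G.infosetActions I, s.prob I a *
          (G.contValue (ownWeight (σ p)) (externalPayoff p σ) (h ++ [a]) -
            G.contValue (ownWeight (σ p)) (externalPayoff p σ) h) := by
  have e : externalPayoff p (Function.update σ p s) = externalPayoff p σ := by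
    funext z
    simp only [externalPayoff, externalReach_update]
  rw [expectedPayoff_eq, expectedPayoff_eq, e, Function.update_self, G.contValue_nil_sub]
  set w := externalPayoff p σ
  have hfilter : nodesOf G.H G.player p = G.internals.filter fun h => G.player h = some p := by
    ext h
    rw [G.mem_nodesOf, Finset.mem_filter]
  rw [← Finset.sum_filter_add_sum_filter_not G.internals (fun h => G.player h = some p),
    ← hfilter, sum_nodesOf, add_eq_left.2]
  · refine Finset.sum_congr rfl fun I hI => Finset.sum_congr rfl fun h hh => ?_
    congr 1
    simp only [mul_sub, Finset.sum_sub_distrib, ← Finset.sum_mul]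
    rw [s.sum_eq_one I hI, one_mul, infosetActions_eq hI hh]
    congr 1
    exact Finset.sum_congr rfl fun a _ => by rw [ownWeight_of_mem hI hh]
  · refine Finset.sum_eq_zero fun h hh => ?_
    rw [Finset.mem_filter] at hh
    rw [contValue_of_not_player _ _ hh.1 hh.2, sub_eq_zero.2, mul_zero]
    exact Finset.sum_congr rfl fun a _ => by rw [ownWeight_of_not_player hh.2, one_mul]

/-- Total regret is bounded by the sum of the immediate counterfactual regrets. -/
lemma totalRegret_le (hG : G.PerfectRecall) (σ : ℕ → G.Profile) (n : ℕ)
    (B : Finset (List Act) → ℝ) (hB0 : ∀ I ∈ (G.infosets p).parts, 0 ≤ B I)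
    (hB : ∀ I ∈ (G.infosets p).parts, ∀ a ∈ G.infosetActions I,
      ∑ m ∈ Finset.range n, G.cfRegret (ownWeight (σ m p)) (externalPayoff p (σ m)) I a ≤ B I) :
    G.totalRegret p σ n ≤ ∑ I ∈ (G.infosets p).parts, B I := by
  have : Nonempty (G.Strategy p) := ⟨σ 0 p⟩
  refine ciSup_le fun s => ?_
  simp only [expectedPayoff_update_sub]
  rw [Finset.sum_comm]
  refine Finset.sum_le_sum fun I hI => ?_
  -- The common own reach `c` depends neither on the round nor on the history in `I`, so it factors
  -- out and leaves a mixture of cumulative counterfactual regrets. Dropping `c ≤ 1` at the end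
  -- needs `0 ≤ B I`.
  obtain ⟨c, hc, hcI⟩ := exists_infoset_reach hG s hI
  have e : ∑ m ∈ Finset.range n, ∑ h ∈ I, pathProd (ownWeight s) 0 h *
        ∑ a ∈ G.infosetActions I, s.prob I a *
          (G.contValue (ownWeight (σ m p)) (externalPayoff p (σ m)) (h ++ [a]) -
            G.contValue (ownWeight (σ m p)) (externalPayoff p (σ m)) h) =
      c * ∑ a ∈ G.infosetActions I, s.prob I a * ∑ m ∈ Finset.range n,
        G.cfRegret (ownWeight (σ m p)) (externalPayoff p (σ m)) I a := by
    simp only [cfRegret, Finset.mul_sum]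
    rw [Finset.sum_comm (s := G.infosetActions I)]
    refine Finset.sum_congr rfl fun m _ => ?_
    rw [Finset.sum_comm]
    exact Finset.sum_congr rfl fun a _ => Finset.sum_congr rfl fun h hh => by rw [hcI h hh]
  rw [e]
  have h1 : ∑ a ∈ G.infosetActions I, s.prob I a * ∑ m ∈ Finset.range n,
        G.cfRegret (ownWeight (σ m p)) (externalPayoff p (σ m)) I a ≤ B I := by
    calc _ ≤ ∑ a ∈ G.infosetActions I, s.prob I a * B I :=
          Finset.sum_le_sum fun a ha =>
            mul_le_mul_of_nonneg_left (hB I hI a ha) (s.nonneg I hI a ha)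
      _ = B I := by rw [← Finset.sum_mul, s.sum_eq_one I hI, one_mul]
  calc _ ≤ c * B I := mul_le_mul_of_nonneg_left h1 hc.1
    _ ≤ B I := mul_le_of_le_one_left (hB0 I hI) hc.2

end Infosets

end Game

namespace Game

variable {Act : Type*} [DecidableEq Act] {G : Game Act}

/-! ### Geometry of one traversal and boundedness of the sampled regret. -/

section Sampling

variable {p : Fin 2}

/-- The traversal with sampled actions `c` meets the history `h`. -/
def ExternalSample.Meets (c : G.ExternalSample p) (h : List Act) : Prop :=
  ∀ g a, g ++ [a] <+: h → G.player g ≠ some p → a = c.choice g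

lemma ExternalSample.Meets.of_prefix {c : G.ExternalSample p} {h z : List Act} (hz : c.Meets z)
    (hp : h <+: z) : c.Meets h :=
  fun g a hg => hz g a (hg.trans hp)

lemma ExternalSample.meets_append_singleton {c : G.ExternalSample p} {h : List Act} {a : Act} :
    c.Meets (h ++ [a]) ↔ c.Meets h ∧ (G.player h ≠ some p → a = c.choice h) := by
  constructor
  · exact fun hm => ⟨hm.of_prefix (List.prefix_append _ _), hm h a List.prefix_rfl⟩
  · rintro ⟨hm, ha⟩ g b hg hp
    rcases List.prefix_concat_iff.1 hg with e | hg
    · obtain ⟨rfl, e2⟩ := List.append_inj' e rfl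
      obtain rfl : b = a := by simpa using e2
      exact ha hp
    · exact hm g b hg hp

lemma ExternalSample.mem_block {c : G.ExternalSample p} {z : List Act} :
    z ∈ c.block ↔ z ∈ G.terminals ∧ c.Meets z := by
  rw [ExternalSample.block, Finset.mem_filter]
  refine and_congr_right fun _ => ⟨?_, fun h i hi => ?_⟩
  · rintro h g a ⟨t, rfl⟩ hp
    have := h ⟨g.length, by simp⟩
    simp only [List.get_eq_getElem] at this
    simpa using this (by simpa using hp)
  · refine h _ _ ?_ hi
    rw [List.get_eq_getElem, List.take_append_getElem]
    exact List.take_prefix _ _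

/-- The terminal payoffs of `p` on the sampled block, and zero elsewhere. -/
def sampledPayoff (c : G.ExternalSample p) (z : List Act) : ℝ :=
  if z ∈ c.block then G.payoff p z else 0

lemma sum_block_filter (c : G.ExternalSample p) (P : List Act → Prop) [DecidablePred P]
    (f : List Act → ℝ) :
    ∑ z ∈ c.block.filter P, G.payoff p z * f z =
      ∑ z ∈ G.terminals.filter P, sampledPayoff c z * f z := by
  have e : c.block.filter P = (G.terminals.filter P).filter fun z => z ∈ c.block := by
    ext z
    simp only [Finset.mem_filter]
    exact ⟨fun h => ⟨⟨(ExternalSample.mem_block.1 h.1).1, h.2⟩, h.1⟩, fun h => ⟨h.2, h.1.2⟩⟩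
  rw [e, Finset.sum_filter]
  refine Finset.sum_congr rfl fun z _ => ?_
  unfold sampledPayoff
  split_ifs <;> simp

/-- Sampled and true regrets are the same functional at different terminal weights: the payoff times
the indicator of the block, or times the external reach. -/
lemma sampledRegret_eq (σ : G.Profile) (c : G.ExternalSample p) (I : Finset (List Act))
    (a : Act) :
    G.sampledRegret p σ c.block I a = G.cfRegret (ownWeight (σ p)) (sampledPayoff c) I a := by
  unfold sampledRegret sampledActionValue sampledValue cfRegret contValue
  rw [← Finset.sum_sub_distrib]
  refine Finset.sum_congr rfl fun h _ => ?_
  simp only [sum_block_filter, ownReachFrom_eq]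

lemma contValue_sampled_of_not_meets (W : List Act → Act → ℝ) (c : G.ExternalSample p)
    {h : List Act} (hm : ¬ c.Meets h) : G.contValue W (sampledPayoff c) h = 0 := by
  refine Finset.sum_eq_zero fun z hz => ?_
  have : z ∉ c.block := fun hb =>
    hm ((ExternalSample.mem_block.1 hb).2.of_prefix (Finset.mem_filter.1 hz).2)
  rw [sampledPayoff, if_neg this, zero_mul]

variable (G p) in
lemma exists_payoff_bounds : ∃ lo hi : ℝ, hi - lo = G.payoffRange p ∧
    ∀ z ∈ G.terminals, G.payoff p z ∈ Set.Icc lo hi := by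
  have hfin : (G.payoff p '' (G.terminals : Set (List Act))).Finite :=
    (Finset.finite_toSet _).image _
  exact ⟨_, _, rfl, fun z hz => ⟨csInf_le hfin.bddBelow ⟨z, hz, rfl⟩,
    le_csSup hfin.bddAbove ⟨z, hz, rfl⟩⟩⟩

variable (G p) in
lemma payoffRange_nonneg : 0 ≤ G.payoffRange p := by
  obtain ⟨lo, hi, e, hb⟩ := exists_payoff_bounds G p
  obtain ⟨z, hz⟩ := G.terminals_nonempty
  have := hb z hz
  rw [← e]
  linarith [this.1, this.2]

/-- Where `p` acts the value averages those of the children, all of them met; elsewhere only the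
sampled child has a nonzero value. So the payoff bounds propagate up from the leaves. -/
lemma contValue_sampled_mem_Icc (s : G.Strategy p) (c : G.ExternalSample p) {lo hi : ℝ}
    (hb : ∀ z ∈ G.terminals, G.payoff p z ∈ Set.Icc lo hi) {h : List Act} (hh : h ∈ G.H)
    (hm : c.Meets h) : G.contValue (ownWeight s) (sampledPayoff c) h ∈ Set.Icc lo hi := by
  obtain ⟨N, hN⟩ : ∃ N, ∀ g ∈ G.H, g.length ≤ N :=
    ⟨G.H.sup List.length, fun g hg => Finset.le_sup (f := List.length) hg⟩
  induction hk : N - h.length using Nat.strong_induction_on generalizing h with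
  | _ k ih =>
  rcases (G.actions h).eq_empty_or_nonempty with hemp | hne
  · have hz := G.mem_terminals.2 ⟨hh, hemp⟩
    rw [G.contValue_terminal _ _ hz, sampledPayoff, if_pos (ExternalSample.mem_block.2 ⟨hz, hm⟩)]
    exact hb h hz
  · have hint := G.mem_internals.2 ⟨hh, hne⟩
    have hstep : ∀ a ∈ G.actions h, c.Meets (h ++ [a]) →
        G.contValue (ownWeight s) (sampledPayoff c) (h ++ [a]) ∈ Set.Icc lo hi := by
      intro a ha hma
      have haH := G.mem_actions.1 ha
      have hlen := hN _ haH
      simp only [List.length_append, List.length_singleton] at hlen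
      exact ih _ (by simp only [List.length_append, List.length_singleton]; omega) haH hma rfl
    by_cases hp : G.player h = some p
    · rw [G.contValue_internal _ _ hint]
      have hI : ∀ a ∈ G.actions h,
          G.contValue (ownWeight s) (sampledPayoff c) (h ++ [a]) ∈ Set.Icc lo hi := fun a ha =>
        hstep a ha (ExternalSample.meets_append_singleton.2 ⟨hm, fun hn => absurd hp hn⟩)
      simpa only [smul_eq_mul] using (convex_Icc lo hi).sum_mem
        (fun a ha => ownWeight_nonneg s ha) (sum_ownWeight s hint hp) hI
    · rw [contValue_of_not_player _ _ hint hp, Finset.sum_eq_single (c.choice h)]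
      · exact hstep _ (c.legal h hh hne hp)
          (ExternalSample.meets_append_singleton.2 ⟨hm, fun _ => rfl⟩)
      · intro a _ hac
        refine contValue_sampled_of_not_meets _ _ fun hma => hac ?_
        exact (ExternalSample.meets_append_singleton.1 hma).2 hp
      · exact fun hn => absurd (c.legal h hh hne hp) hn

/-- Histories that one traversal meets are comparable if the traverser's own sequences agree. -/
lemma take_eq_take_of_meets {c : G.ExternalSample p} {h h' : List Act} (hm : c.Meets h)
    (hm' : c.Meets h') (hs : G.ownSequence p h = G.ownSequence p h') {n : ℕ}
    (hn : n ≤ h.length) (hn' : n ≤ h'.length) : h.take n = h'.take n := by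
  induction n with
  | zero => simp
  | succ n ih =>
    have e := ih (by omega) (by omega)
    have h1 : h.take (n + 1) = h.take n ++ [h[n]] := (List.take_append_getElem (by omega)).symm
    have h2 : h'.take (n + 1) = h.take n ++ [h'[n]] := by
      rw [e]
      exact (List.take_append_getElem (by omega)).symm
    have p1 : h.take n ++ [h[n]] <+: h := h1 ▸ List.take_prefix _ _
    have p2 : h.take n ++ [h'[n]] <+: h' := h2 ▸ List.take_prefix _ _
    rw [h1, h2]
    congr 2
    -- The next action is dictated by the common own sequence where `p` acts, and by the sample
    -- everywhere else.
    by_cases hp : G.player (h.take n) = some p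
    · have q1 := G.ownSequence_prefix p p1
      have q2 := G.ownSequence_prefix p p2
      rw [ownSequence_append_singleton, if_pos hp] at q1 q2
      rw [← hs] at q2
      have := eq_of_append_singleton_prefix q1 q2
      exact (Prod.mk.inj this).2
    · rw [hm _ _ p1 hp, hm' _ _ p2 hp]

/-- Acting at `h` makes the own sequence strictly longer. -/
lemma not_prefix_append_singleton_of_ownSequence_eq {h h' : List Act} {a : Act}
    (hp : G.player h = some p) (hs : G.ownSequence p h = G.ownSequence p h') :
    ¬ h ++ [a] <+: h' := by
  intro hpre
  have := (G.ownSequence_prefix p hpre).length_le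
  rw [ownSequence_append_singleton, if_pos hp, ← hs] at this
  simp at this

lemma eq_of_meets_of_length_le {c : G.ExternalSample p} {h h' : List Act} (hm : c.Meets h)
    (hm' : c.Meets h') (hs : G.ownSequence p h = G.ownSequence p h')
    (hp : G.player h = some p) (hl : h.length ≤ h'.length) : h = h' := by
  have e := take_eq_take_of_meets hm hm' hs le_rfl hl
  rw [List.take_length] at e
  rcases hl.eq_or_lt with hl | hl
  · rw [e, hl, List.take_length]
  · refine absurd ?_ (not_prefix_append_singleton_of_ownSequence_eq (a := h'[h.length]) hp hs)
    nth_rw 1 [e]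
    rw [List.take_append_getElem]
    exact List.take_prefix _ _

/-- Two met histories with equal own sequences are comparable, and a proper extension would have a
longer own sequence. -/
lemma eq_of_meets_of_mem (hG : G.PerfectRecall) {c : G.ExternalSample p} {I : Finset (List Act)}
    (hI : I ∈ (G.infosets p).parts) {h h' : List Act} (hh : h ∈ I) (hh' : h' ∈ I)
    (hm : c.Meets h) (hm' : c.Meets h') : h = h' := by
  have hs := hG p I hI h hh h' hh'
  rcases le_total h.length h'.length with hl | hl
  · exact eq_of_meets_of_length_le hm hm' hs (mem_nodesOf_of_mem_infoset hI hh).2 hl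
  · exact (eq_of_meets_of_length_le hm' hm hs.symm (mem_nodesOf_of_mem_infoset hI hh').2 hl).symm

/-- At most one history of `I` contributes, and its term is a difference of two values lying between
the extreme payoffs. -/
lemma abs_sampledRegret_le (hG : G.PerfectRecall) (σ : G.Profile) (c : G.ExternalSample p)
    {I : Finset (List Act)} (hI : I ∈ (G.infosets p).parts) {a : Act}
    (ha : a ∈ G.infosetActions I) :
    |G.sampledRegret p σ c.block I a| ≤ G.payoffRange p := by
  rw [sampledRegret_eq, cfRegret]
  by_cases hex : ∃ h ∈ I, c.Meets h
  · obtain ⟨h, hh, hm⟩ := hex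
    rw [Finset.sum_eq_single_of_mem h hh]
    · obtain ⟨lo, hi, e, hb⟩ := exists_payoff_bounds G p
      obtain ⟨hint, hp⟩ := mem_nodesOf_of_mem_infoset hI hh
      rw [infosetActions_eq hI hh] at ha
      have h1 := contValue_sampled_mem_Icc (σ p) c hb (G.mem_actions.1 ha)
        (ExternalSample.meets_append_singleton.2 ⟨hm, fun hn => absurd hp hn⟩)
      have h2 := contValue_sampled_mem_Icc (σ p) c hb (G.mem_internals.1 hint).1 hm
      rw [← e, abs_le]
      constructor <;> linarith [h1.1, h1.2, h2.1, h2.2]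
    · intro h' hh' hne
      have hm' : ¬ c.Meets h' := fun hm' => hne (eq_of_meets_of_mem hG hI hh' hh hm' hm)
      rw [contValue_sampled_of_not_meets _ _ hm', contValue_sampled_of_not_meets, sub_zero]
      exact fun h => hm' (ExternalSample.meets_append_singleton.1 h).1
  · push Not at hex
    rw [Finset.sum_eq_zero, abs_zero]
    · exact payoffRange_nonneg G p
    · intro h' hh'
      rw [contValue_sampled_of_not_meets _ _ (hex h' hh'), contValue_sampled_of_not_meets, sub_zero]
      exact fun h => hex h' hh' (ExternalSample.meets_append_singleton.1 h).1

end Sampling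

end Game

/-! ### Blackwell's potential bound for regret matching. -/

section RegretMatching

/-- One step of the potential: the cross term is weighted by the positive part, so regret matching
cancels it after summing over actions. -/
lemma sq_max_add_le (x y : ℝ) :
    max (x + y) 0 ^ 2 ≤ max x 0 ^ 2 + 2 * max x 0 * y + y ^ 2 := by
  rcases le_total x 0 with hx | hx <;> rcases le_total (x + y) 0 with hy | hy
  · simp only [max_eq_right hx, max_eq_right hy]; nlinarith [sq_nonneg y]
  · simp only [max_eq_right hx, max_eq_left hy]; nlinarith [sq_nonneg y]
  · simp only [max_eq_left hx, max_eq_right hy]; nlinarith [sq_nonneg (x + y)]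
  · simp only [max_eq_left hx, max_eq_left hy]; nlinarith

/-- Blackwell's potential argument for regret matching. -/
lemma sum_sq_max_regret_le {ι : Type*} (A : Finset ι) (r : ℕ → ι → ℝ) {C : ℝ}
    (hr : ∀ t, ∀ a ∈ A, |r t a| ≤ C)
    (horth : ∀ t, ∑ a ∈ A, max (∑ k ∈ Finset.range t, r k a) 0 * r t a = 0) (T : ℕ) :
    ∑ a ∈ A, max (∑ k ∈ Finset.range T, r k a) 0 ^ 2 ≤ T * A.card * C ^ 2 := by
  induction T with
  | zero => simp
  | succ T ih =>
    have h1 : ∑ a ∈ A, max (∑ k ∈ Finset.range (T + 1), r k a) 0 ^ 2 ≤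
        ∑ a ∈ A, (max (∑ k ∈ Finset.range T, r k a) 0 ^ 2 +
          2 * (max (∑ k ∈ Finset.range T, r k a) 0 * r T a) + C ^ 2) := by
      refine Finset.sum_le_sum fun a ha => ?_
      rw [Finset.sum_range_succ]
      refine (sq_max_add_le _ _).trans ?_
      have : r T a ^ 2 ≤ C ^ 2 := sq_le_sq' (neg_le_of_abs_le (hr T a ha)) (le_of_abs_le (hr T a ha))
      linarith
    rw [Finset.sum_add_distrib, Finset.sum_add_distrib, ← Finset.mul_sum, horth,
      Finset.sum_const, nsmul_eq_mul] at h1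
    push_cast
    linarith

end RegretMatching

/-! ### Second moments of martingale sums and Markov's inequality. -/

section Martingale

variable {Ω : Type*} {m : MeasurableSpace Ω} {μ : Measure Ω} [IsProbabilityMeasure μ]

/-- The sum of the deviations of bounded random variables from their predictable means has
second moment growing at most linearly. -/
lemma integral_sq_sum_sub_le {ℱ : Filtration ℕ m} {x y : ℕ → Ω → ℝ} {C B : ℝ}
    (hx : ∀ n, Measurable[ℱ (n + 1)] (x n)) (hy : ∀ n, Measurable[ℱ n] (y n))
    (hxC : ∀ n ω, |x n ω| ≤ C) (hyB : ∀ n ω, |y n ω| ≤ B)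
    (hxy : ∀ n, μ[x n | ℱ n] =ᵐ[μ] y n) (n : ℕ) :
    ∫ ω, (∑ k ∈ Finset.range n, (y k ω - x k ω)) ^ 2 ∂μ ≤ n * C ^ 2 := by
  have hbdd : ∀ {f : Ω → ℝ} {c : ℝ}, Measurable f → (∀ ω, |f ω| ≤ c) → Integrable f μ :=
    fun hf hc => Integrable.of_bound hf.aestronglyMeasurable _ (.of_forall hc)
  have hxm : ∀ k, Measurable (x k) := fun k => (hx k).mono (ℱ.le _) le_rfl
  have hym : ∀ k, Measurable (y k) := fun k => (hy k).mono (ℱ.le _) le_rfl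
  have hxi : ∀ k, Integrable (x k) μ := fun k => hbdd (hxm k) (hxC k)
  -- Against a bounded multiplier known before round `k`, `x k` may be replaced by its conditional
  -- mean. It is used below with the past sum `D` and with `y n`. The bounds `b` and `B` only secure
  -- integrability.
  have hswap : ∀ k (g : Ω → ℝ) (b : ℝ), Measurable[ℱ k] g → (∀ ω, |g ω| ≤ b) →
      ∫ ω, g ω * x k ω ∂μ = ∫ ω, g ω * y k ω ∂μ := by
    intro k g b hg hb
    have hgx : Integrable (g * x k) μ :=
      (hxi k).bdd_mul (hg.mono (ℱ.le _) le_rfl).aestronglyMeasurable (c := b) (.of_forall hb)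
    have h1 := condExp_mul_of_stronglyMeasurable_left (μ := μ) (m := ℱ k) hg.stronglyMeasurable
      hgx (hxi k)
    calc ∫ ω, g ω * x k ω ∂μ = ∫ ω, (μ[g * x k | ℱ k]) ω ∂μ := (integral_condExp (ℱ.le k)).symm
      _ = ∫ ω, g ω * y k ω ∂μ := by
        refine integral_congr_ae ?_
        filter_upwards [h1, hxy k] with ω e1 e2
        rw [e1, Pi.mul_apply, e2]
  induction n with
  | zero => simp
  | succ n ih =>
    set D : Ω → ℝ := fun ω => ∑ k ∈ Finset.range n, (y k ω - x k ω) with hD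
    have hDm : Measurable[ℱ n] D := by
      refine Finset.measurable_sum _ fun k hk => ?_
      have hk := Finset.mem_range.1 hk
      exact ((hy k).mono (ℱ.mono hk.le) le_rfl).sub ((hx k).mono (ℱ.mono hk) le_rfl)
    have hDm' : Measurable D := hDm.mono (ℱ.le _) le_rfl
    have hDb : ∀ ω, |D ω| ≤ n * (B + C) := by
      intro ω
      refine (Finset.abs_sum_le_sum_abs _ _).trans ?_
      refine (Finset.sum_le_card_nsmul _ _ (B + C) fun k _ => ?_).trans
        (by rw [nsmul_eq_mul, Finset.card_range])
      exact (abs_sub _ _).trans (add_le_add (hyB k ω) (hxC k ω))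
    have hmul : ∀ {f g : Ω → ℝ} {b c : ℝ}, Measurable f → Measurable g → (∀ ω, |f ω| ≤ b) →
        (∀ ω, |g ω| ≤ c) → Integrable (fun ω => f ω * g ω) μ := fun hf hg hb hc =>
      (hbdd hg hc).bdd_mul hf.aestronglyMeasurable (.of_forall hb)
    have iDD := hmul hDm' hDm' hDb hDb
    have iDy := hmul hDm' (hym n) hDb (hyB n)
    have iDx := hmul hDm' (hxm n) hDb (hxC n)
    have iyy := hmul (hym n) (hym n) (hyB n) (hyB n)
    have iyx := hmul (hym n) (hxm n) (hyB n) (hxC n)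
    have ixx := hmul (hxm n) (hxm n) (hxC n) (hxC n)
    have e : ∀ ω, (∑ k ∈ Finset.range (n + 1), (y k ω - x k ω)) ^ 2 =
        D ω * D ω + 2 * (D ω * y n ω - D ω * x n ω) +
          (y n ω * y n ω - 2 * (y n ω * x n ω) + x n ω * x n ω) := by
      intro ω
      rw [Finset.sum_range_succ]
      change (D ω + _) ^ 2 = _
      ring
    simp only [e]
    have i1 : Integrable (fun ω => 2 * (D ω * y n ω - D ω * x n ω)) μ :=
      (iDy.sub iDx).const_mul 2
    have i2 : Integrable (fun ω => D ω * D ω + 2 * (D ω * y n ω - D ω * x n ω)) μ := iDD.add i1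
    have i3 : Integrable (fun ω => 2 * (y n ω * x n ω)) μ := iyx.const_mul 2
    have i4 : Integrable (fun ω => y n ω * y n ω - 2 * (y n ω * x n ω)) μ := iyy.sub i3
    have i5 : Integrable (fun ω => y n ω * y n ω - 2 * (y n ω * x n ω) + x n ω * x n ω) μ :=
      i4.add ixx
    -- The cross term with `D` cancels, and the new square contributes `E[x²] - E[y²]`, at most `C ^
    -- 2`.
    rw [integral_add i2 i5, integral_add iDD i1, integral_const_mul, integral_sub iDy iDx,
      integral_add i4 ixx, integral_sub iyy i3, integral_const_mul, hswap n D _ hDm hDb,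
      hswap n (y n) _ (hy n) (hyB n)]
    have h1 : ∫ ω, D ω * D ω ∂μ ≤ n * C ^ 2 := by
      simpa only [← sq] using ih
    have h2 : ∫ ω, x n ω * x n ω ∂μ ≤ C ^ 2 := by
      refine (integral_mono ixx (integrable_const (C ^ 2)) fun ω => ?_).trans (by simp)
      change x n ω * x n ω ≤ C ^ 2
      rw [← sq]
      exact sq_le_sq' (neg_le_of_abs_le (hxC n ω)) (le_of_abs_le (hxC n ω))
    have h3 : 0 ≤ ∫ ω, y n ω * y n ω ∂μ := integral_nonneg fun ω => mul_self_nonneg _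
    push_cast
    linarith

/-- Markov's inequality with the threshold `c / ε`, where `c` may be zero. -/
lemma ofReal_one_sub_le_measure {Y : Ω → ℝ} (hY : Measurable Y) (hYi : Integrable Y μ)
    (hY0 : ∀ ω, 0 ≤ Y ω) {c ε : ℝ} (hc : ∫ ω, Y ω ∂μ ≤ c) (hε : 0 < ε) :
    ENNReal.ofReal (1 - ε) ≤ μ {ω | Y ω ≤ c / ε} := by
  have hmeas : MeasurableSet {ω | Y ω ≤ c / ε} := measurableSet_le hY measurable_const
  have hc0 : 0 ≤ c := (integral_nonneg hY0).trans hc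
  have hbad : μ.real {ω | Y ω ≤ c / ε}ᶜ ≤ ε := by
    -- For `c = 0` the threshold is zero and Markov's inequality is vacuous; instead `Y` vanishes
    -- almost everywhere.
    rcases hc0.eq_or_lt with rfl | hc0
    · have h0 : Y =ᵐ[μ] 0 := (integral_eq_zero_iff_of_nonneg hY0 hYi).1
        (le_antisymm hc (integral_nonneg hY0))
      have : μ.real {ω | Y ω ≤ 0 / ε}ᶜ = 0 := by
        rw [measureReal_eq_zero_iff]
        refine measure_mono_null (fun ω hω => ?_) (ae_iff.1 h0)
        simp only [zero_div, Set.mem_compl_iff, Set.mem_ofPred_eq, not_le] at hω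
        exact hω.ne'
      linarith
    · have hM := mul_meas_ge_le_integral_of_nonneg (.of_forall hY0) hYi (c / ε)
      have hsub : μ.real {ω | Y ω ≤ c / ε}ᶜ ≤ μ.real {ω | c / ε ≤ Y ω} :=
        by
        refine measureReal_mono fun ω hω => ?_
        simp only [Set.mem_compl_iff, Set.mem_ofPred_eq, not_le] at hω
        exact hω.le
      have h1 : c / ε * μ.real {ω | Y ω ≤ c / ε}ᶜ ≤ c / ε * ε := by
        rw [div_mul_cancel₀ _ hε.ne']
        exact (mul_le_mul_of_nonneg_left hsub (by positivity)).trans (hM.trans hc)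
      exact le_of_mul_le_mul_left h1 (by positivity)
  rw [probReal_compl_eq_one_sub hmeas] at hbad
  rw [← ofReal_measureReal]
  exact ENNReal.ofReal_le_ofReal (by linarith)

end Martingale

namespace Game

variable {Act : Type*} [DecidableEq Act] {G : Game Act}

/-! ### The regret as a linear function of the terminal weights. -/

section Coefficients

variable {p : Fin 2}

/-- The coefficient of the weight of the terminal history `z` in the regret at `I` for not
having played `a`. -/
def regretCoeff (W : List Act → Act → ℝ) (I : Finset (List Act)) (a : Act) (z : List Act) : ℝ :=
  ∑ h ∈ I, ((if h ++ [a] <+: z then pathProd W (h ++ [a]).length z else 0) -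
    (if h <+: z then pathProd W h.length z else 0))

/-- The coefficients depend only on the step weights, which are known before the round; conditioning
on the past therefore acts on `w` alone. -/
lemma cfRegret_eq_sum (W : List Act → Act → ℝ) (w : List Act → ℝ) (I : Finset (List Act))
    (a : Act) : G.cfRegret W w I a = ∑ z ∈ G.terminals, w z * regretCoeff W I a z := by
  simp only [cfRegret, contValue, regretCoeff, Finset.sum_filter, Finset.mul_sum]
  rw [Finset.sum_comm (s := G.terminals)]
  refine Finset.sum_congr rfl fun h _ => ?_
  rw [← Finset.sum_sub_distrib]
  refine Finset.sum_congr rfl fun z _ => ?_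
  rw [mul_sub]
  congr 1 <;> split_ifs <;> simp

/-- A crude bound, which serves integrability and does not enter the rate. -/
lemma abs_regretCoeff_le (s : G.Strategy p) (I : Finset (List Act)) (a : Act) {z : List Act}
    (hz : z ∈ G.terminals) : |regretCoeff (ownWeight s) I a z| ≤ I.card := by
  have hP : ∀ n, pathProd (ownWeight s) n z ∈ Set.Icc (0 : ℝ) 1 := fun n =>
    pathProd_mem_Icc (fun g b hp =>
      ownWeight_mem_Icc s (G.mem_actions_of_prefix (G.mem_terminals.1 hz).1 hp)) n
  have hite : ∀ (P : Prop) [Decidable P] (n : ℕ),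
      (if P then pathProd (ownWeight s) n z else 0) ∈ Set.Icc (0 : ℝ) 1 := by
    intro P _ n
    split_ifs
    · exact hP n
    · simp
  refine (Finset.abs_sum_le_sum_abs _ _).trans ?_
  refine (Finset.sum_le_card_nsmul _ _ 1 fun h _ => ?_).trans (by simp)
  have h1 := hite (h ++ [a] <+: z) (h ++ [a]).length
  have h2 := hite (h <+: z) h.length
  rw [abs_le]
  constructor <;> linarith [h1.1, h1.2, h2.1, h2.2]

end Coefficients

/-! ### Measurability of reach and regret coefficients. -/

section Measurability

variable {p : Fin 2} {Ω : Type*} {m : MeasurableSpace Ω}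

lemma measurable_ownWeight {q : Fin 2} {s : Ω → G.Strategy q}
    (hs : ∀ I ∈ (G.infosets q).parts, ∀ a ∈ G.infosetActions I, Measurable fun ω => (s ω).prob I a)
    {h : List Act} {a : Act} (ha : a ∈ G.actions h) : Measurable fun ω => ownWeight (s ω) h a := by
  by_cases hp : G.player h = some q
  · have hh := G.mem_internals_of_mem_actions ha
    have hI := infosetAt_mem_parts hh hp
    simp only [ownWeight_of_player hp]
    exact hs _ hI _ (by rwa [infosetActions_eq hI (mem_infosetAt hh hp)])
  · simp only [ownWeight_of_not_player hp]
    exact measurable_const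

lemma measurable_externalReach {σ : Ω → G.Profile}
    (hσ : ∀ q, ∀ I ∈ (G.infosets q).parts, ∀ a ∈ G.infosetActions I,
      Measurable fun ω => (σ ω q).prob I a) {z : List Act} (hz : z ∈ G.terminals) :
    Measurable fun ω => G.externalReach p (σ ω) z := by
  refine measurable_pathProd (fun h a hp => ?_) 0
  have ha := G.mem_actions_of_prefix (G.mem_terminals.1 hz).1 hp
  split_ifs
  · exact measurable_const
  · rcases hq : G.player h with _ | q
    · simp only [actProb, hq]
      exact measurable_const
    · simp only [actProb_eq_ownWeight G _ hq]
      exact measurable_ownWeight (hσ q) ha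

lemma measurable_regretCoeff {s : Ω → G.Strategy p}
    (hs : ∀ I ∈ (G.infosets p).parts, ∀ a ∈ G.infosetActions I, Measurable fun ω => (s ω).prob I a)
    (I : Finset (List Act)) (a : Act) {z : List Act} (hz : z ∈ G.terminals) :
    Measurable fun ω => regretCoeff (ownWeight (s ω)) I a z := by
  have hP : ∀ n, Measurable fun ω => pathProd (ownWeight (s ω)) n z := fun n =>
    measurable_pathProd (fun h b hp =>
      measurable_ownWeight hs (G.mem_actions_of_prefix (G.mem_terminals.1 hz).1 hp)) n
  unfold regretCoeff
  refine Finset.measurable_sum _ fun h _ => Measurable.sub ?_ ?_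
  · split_ifs
    · exact hP _
    · exact measurable_const
  · split_ifs
    · exact hP _
    · exact measurable_const

end Measurability

/-! ### Regret of a run of the algorithm. -/

namespace KESRun

variable {p : Fin 2} {K : ℕ} {Ω : Type*} [m : MeasurableSpace Ω] {μ : Measure Ω}
  (X : KESRun G p K μ)

/-- The sampled regret of round `n`. -/
def sampled (I : Finset (List Act)) (a : Act) (n : ℕ) (ω : Ω) : ℝ :=
  G.sampledRegret p (X.σ n ω) (X.sample n ω).block I a

/-- The true counterfactual regret of round `n`. -/
def counterfactual (I : Finset (List Act)) (a : Act) (n : ℕ) (ω : Ω) : ℝ :=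
  G.cfRegret (ownWeight (X.σ n ω p)) (externalPayoff p (X.σ n ω)) I a

/-- The part of the sampled regret of round `n` that is contributed by `z` if it is sampled. -/
def gain (I : Finset (List Act)) (a : Act) (n : ℕ) (z : List Act) (ω : Ω) : ℝ :=
  G.payoff p z * regretCoeff (ownWeight (X.σ n ω p)) I a z

lemma measurable_gain (I : Finset (List Act)) (a : Act) (n : ℕ) {z : List Act}
    (hz : z ∈ G.terminals) : Measurable[X.ℱ n] (X.gain I a n z) :=
  Measurable.const_mul (measurable_regretCoeff (X.strategy_measurable n p) I a hz) _

lemma abs_gain_le (I : Finset (List Act)) (a : Act) (n : ℕ) {z : List Act}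
    (hz : z ∈ G.terminals) (ω : Ω) : |X.gain I a n z ω| ≤ |G.payoff p z| * I.card := by
  rw [gain, abs_mul]
  exact mul_le_mul_of_nonneg_left (abs_regretCoeff_le _ _ _ hz) (abs_nonneg _)

lemma sampled_eq (I : Finset (List Act)) (a : Act) (n : ℕ) :
    X.sampled I a n = ∑ z ∈ G.terminals, X.gain I a n z *
      {ω | z ∈ (X.sample n ω).block}.indicator (fun _ => (1 : ℝ)) := by
  funext ω
  rw [sampled, sampledRegret_eq, cfRegret_eq_sum, Finset.sum_apply]
  refine Finset.sum_congr rfl fun z _ => ?_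
  by_cases hz : z ∈ (X.sample n ω).block <;> simp [sampledPayoff, gain, hz]

lemma counterfactual_eq (I : Finset (List Act)) (a : Act) (n : ℕ) (ω : Ω) :
    X.counterfactual I a n ω =
      ∑ z ∈ G.terminals, X.gain I a n z ω * G.externalReach p (X.σ n ω) z := by
  rw [counterfactual, cfRegret_eq_sum]
  refine Finset.sum_congr rfl fun z _ => ?_
  rw [externalPayoff, gain]
  ring

lemma measurable_sampled (I : Finset (List Act)) (a : Act) (n : ℕ) :
    Measurable[X.ℱ (n + 1)] (X.sampled I a n) := by
  have e : X.sampled I a n = fun ω => ∑ z ∈ G.terminals, (X.gain I a n z *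
      {ω | z ∈ (X.sample n ω).block}.indicator (fun _ => (1 : ℝ))) ω := by
    funext ω
    rw [sampled_eq, Finset.sum_apply]
  rw [e]
  refine Finset.measurable_sum _ fun z hz => ?_
  exact ((X.measurable_gain I a n hz).mono (X.ℱ.mono n.le_succ) le_rfl).mul
    (measurable_const.indicator (X.block_measurable n z hz))

lemma measurable_counterfactual (I : Finset (List Act)) (a : Act) (n : ℕ) :
    Measurable[X.ℱ n] (X.counterfactual I a n) := by
  rw [funext (X.counterfactual_eq I a n)]
  refine Finset.measurable_sum _ fun z hz => ?_
  exact (X.measurable_gain I a n hz).mul (measurable_externalReach (X.strategy_measurable n) hz)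

lemma abs_counterfactual_le (I : Finset (List Act)) (a : Act) (n : ℕ) (ω : Ω) :
    |X.counterfactual I a n ω| ≤ ∑ z ∈ G.terminals, |G.payoff p z| * I.card := by
  rw [counterfactual_eq]
  refine (Finset.abs_sum_le_sum_abs _ _).trans (Finset.sum_le_sum fun z hz => ?_)
  have h := G.externalReach_mem_Icc (p := p) (X.σ n ω) hz
  rw [abs_mul, abs_of_nonneg h.1]
  exact (mul_le_of_le_one_right (abs_nonneg _) h.2).trans (X.abs_gain_le I a n hz ω)

/-- The sampling probability of `z` is its external reach, so averaging the block indicators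
restores the external factor of the counterfactual regret. Only the marginal law of each `z`
matters, by linearity. -/
lemma condExp_sampled [IsProbabilityMeasure μ] (I : Finset (List Act)) (a : Act) (n : ℕ) :
    μ[X.sampled I a n | X.ℱ n] =ᵐ[μ] X.counterfactual I a n := by
  have hind : ∀ z ∈ G.terminals,
      Integrable ({ω | z ∈ (X.sample n ω).block}.indicator fun _ => (1 : ℝ)) μ := fun z hz =>
    (integrable_const (1 : ℝ)).indicator (X.ℱ.le _ _ (X.block_measurable n z hz))
  have hint : ∀ z ∈ G.terminals, Integrable (X.gain I a n z *
      {ω | z ∈ (X.sample n ω).block}.indicator (fun _ => (1 : ℝ))) μ := fun z hz =>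
    (hind z hz).bdd_mul ((X.measurable_gain I a n hz).mono (X.ℱ.le _) le_rfl).aestronglyMeasurable
      (.of_forall (X.abs_gain_le I a n hz))
  have hz : ∀ᵐ ω ∂μ, ∀ z ∈ G.terminals, (μ[X.gain I a n z *
      {ω | z ∈ (X.sample n ω).block}.indicator (fun _ => (1 : ℝ)) | X.ℱ n]) ω =
        X.gain I a n z ω * G.externalReach p (X.σ n ω) z := by
    rw [Filter.eventually_all_finset]
    intro z hz
    filter_upwards [condExp_mul_of_stronglyMeasurable_left
      (X.measurable_gain I a n hz).stronglyMeasurable (hint z hz) (hind z hz),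
      X.sample_law n z hz] with ω h1 h2
    rw [h1, Pi.mul_apply, h2]
  rw [sampled_eq]
  filter_upwards [condExp_finsetSum hint (X.ℱ n), hz] with ω h1 h2
  rw [h1, Finset.sum_apply, counterfactual_eq]
  exact Finset.sum_congr rfl h2

lemma sum_blocks (f : ℕ → ℝ) (t : ℕ) :
    ∑ k ∈ Finset.range t, ∑ d ∈ Finset.range K, f (k * K + d) = ∑ n ∈ Finset.range (t * K), f n := by
  induction t with
  | zero => simp
  | succ t ih => rw [Finset.sum_range_succ, ih, Nat.succ_mul, Finset.sum_range_add]

/-- The regret matching bound on the sampled regrets of a run. -/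
lemma sum_sq_max_sampled_le (hG : G.PerfectRecall) {I : Finset (List Act)}
    (hI : I ∈ (G.infosets p).parts) (T : ℕ) (ω : Ω) :
    ∑ a ∈ G.infosetActions I, max (∑ n ∈ Finset.range (T * K), X.sampled I a n ω) 0 ^ 2 ≤
      T * (G.infosetActions I).card * (K * G.payoffRange p) ^ 2 := by
  -- One Blackwell step is a whole iteration: all its `K` rounds use the regrets at its start, so
  -- orthogonality holds round by round, and the step is bounded by `K Δ`.
  have h := sum_sq_max_regret_le (G.infosetActions I)
    (fun t a => ∑ d ∈ Finset.range K, X.sampled I a (t * K + d) ω) (C := K * G.payoffRange p)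
    (fun t a ha => ?_) (fun t => ?_) T
  · simpa only [fun a t => sum_blocks (K := K) (fun n => X.sampled I a n ω) t] using h
  · refine (Finset.abs_sum_le_sum_abs _ _).trans ?_
    refine (Finset.sum_le_card_nsmul _ _ (G.payoffRange p) fun d _ =>
      abs_sampledRegret_le hG _ _ hI ha).trans ?_
    rw [nsmul_eq_mul, Finset.card_range]
  · simp only [fun a t => sum_blocks (K := K) (fun n => X.sampled I a n ω) t, Finset.mul_sum]
    rw [Finset.sum_comm]
    refine Finset.sum_eq_zero fun d hd => ?_
    set R : Act → ℝ := fun b => max (∑ n ∈ Finset.range (t * K), X.sampled I b n ω) 0 with hR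
    have hR0 : ∀ b ∈ G.infosetActions I, 0 ≤ R b := fun b _ => le_max_right _ _
    change ∑ a ∈ G.infosetActions I, R a * X.sampled I a (t * K + d) ω = 0
    -- If no regret is positive, all the weights `R a` vanish and the arbitrary strategy is
    -- harmless.
    rcases (Finset.sum_nonneg hR0).eq_or_lt with h0 | hpos
    · have hz := (Finset.sum_eq_zero_iff_of_nonneg hR0).1 h0.symm
      exact Finset.sum_eq_zero fun a ha => by rw [hz a ha, zero_mul]
    · have hprob : ∀ a ∈ G.infosetActions I,
          R a = (∑ b ∈ G.infosetActions I, R b) * (X.σ (t * K + d) ω p).prob I a := by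
        intro a ha
        have := X.regret_matching t d (Finset.mem_range.1 hd) ω I hI hpos a ha
        rw [this]
        exact (mul_div_cancel₀ _ hpos.ne').symm
      have hz := sum_prob_mul_cfRegret (X.σ (t * K + d) ω p)
        (sampledPayoff (X.sample (t * K + d) ω)) hI
      calc _ = ∑ a ∈ G.infosetActions I, (∑ b ∈ G.infosetActions I, R b) *
            ((X.σ (t * K + d) ω p).prob I a * G.cfRegret (ownWeight (X.σ (t * K + d) ω p))
              (sampledPayoff (X.sample (t * K + d) ω)) I a) := by
            refine Finset.sum_congr rfl fun a ha => ?_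
            rw [hprob a ha, mul_assoc, sampled, sampledRegret_eq]
        _ = 0 := by rw [← Finset.mul_sum, hz, mul_zero]

/-- The amount by which the true cumulative regret exceeds the sampled one. -/
def deviation (n : ℕ) (I : Finset (List Act)) (a : Act) (ω : Ω) : ℝ :=
  ∑ k ∈ Finset.range n, (X.counterfactual I a k ω - X.sampled I a k ω)

lemma measurable_deviation (n : ℕ) (I : Finset (List Act)) (a : Act) :
    Measurable (X.deviation n I a) :=
  Finset.measurable_sum _ fun k _ =>
    ((X.measurable_counterfactual I a k).mono (X.ℱ.le _) le_rfl).sub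
      ((X.measurable_sampled I a k).mono (X.ℱ.le _) le_rfl)

lemma abs_deviation_le (hG : G.PerfectRecall) (n : ℕ) {I : Finset (List Act)}
    (hI : I ∈ (G.infosets p).parts) {a : Act} (ha : a ∈ G.infosetActions I) (ω : Ω) :
    |X.deviation n I a ω| ≤
      n * ((∑ z ∈ G.terminals, |G.payoff p z| * I.card) + G.payoffRange p) := by
  refine (Finset.abs_sum_le_sum_abs _ _).trans ?_
  refine (Finset.sum_le_card_nsmul _ _ _ fun k _ => (abs_sub _ _).trans
    (add_le_add (X.abs_counterfactual_le I a k ω)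
      (abs_sampledRegret_le hG _ _ hI ha))).trans ?_
  rw [nsmul_eq_mul, Finset.card_range]

lemma integrable_sq_deviation [IsProbabilityMeasure μ] (hG : G.PerfectRecall) (n : ℕ)
    {I : Finset (List Act)} (hI : I ∈ (G.infosets p).parts) {a : Act}
    (ha : a ∈ G.infosetActions I) : Integrable (fun ω => X.deviation n I a ω ^ 2) μ := by
  refine Integrable.of_bound ((X.measurable_deviation n I a).pow_const 2).aestronglyMeasurable
    ((n * ((∑ z ∈ G.terminals, |G.payoff p z| * I.card) + G.payoffRange p)) ^ 2)
    (.of_forall fun ω => ?_)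
  rw [norm_pow, Real.norm_eq_abs]
  exact pow_le_pow_left₀ (abs_nonneg _) (X.abs_deviation_le hG n hI ha ω) 2

lemma integral_sq_deviation_le [IsProbabilityMeasure μ] (hG : G.PerfectRecall) (n : ℕ)
    {I : Finset (List Act)} (hI : I ∈ (G.infosets p).parts) {a : Act}
    (ha : a ∈ G.infosetActions I) :
    ∫ ω, X.deviation n I a ω ^ 2 ∂μ ≤ n * G.payoffRange p ^ 2 :=
  integral_sq_sum_sub_le (X.measurable_sampled I a) (X.measurable_counterfactual I a)
    (fun _ _ => abs_sampledRegret_le hG _ _ hI ha) (X.abs_counterfactual_le I a)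
    (X.condExp_sampled I a) n

/-- The sum of the squared deviations over all information sets and actions. -/
def totalDeviation (n : ℕ) (ω : Ω) : ℝ :=
  ∑ I ∈ (G.infosets p).parts, ∑ a ∈ G.infosetActions I, X.deviation n I a ω ^ 2

lemma totalDeviation_nonneg (n : ℕ) (ω : Ω) : 0 ≤ X.totalDeviation n ω :=
  Finset.sum_nonneg fun _ _ => Finset.sum_nonneg fun _ _ => sq_nonneg _

lemma measurable_totalDeviation (n : ℕ) : Measurable (X.totalDeviation n) :=
  Finset.measurable_sum _ fun I _ => Finset.measurable_sum _ fun a _ =>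
    (X.measurable_deviation n I a).pow_const 2

lemma integrable_totalDeviation [IsProbabilityMeasure μ] (hG : G.PerfectRecall) (n : ℕ) :
    Integrable (X.totalDeviation n) μ :=
  integrable_finsetSum _ fun _ hI => integrable_finsetSum _ fun _ ha =>
    X.integrable_sq_deviation hG n hI ha

lemma integral_totalDeviation_le [IsProbabilityMeasure μ] (hG : G.PerfectRecall) (n : ℕ) :
    ∫ ω, X.totalDeviation n ω ∂μ ≤
      G.numInfosets p * (G.maxActions * (n * G.payoffRange p ^ 2)) := by
  unfold totalDeviation
  rw [integral_finsetSum _ fun I hI => integrable_finsetSum _ fun a ha =>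
    X.integrable_sq_deviation hG n hI ha]
  refine (Finset.sum_le_card_nsmul _ _ (G.maxActions * (n * G.payoffRange p ^ 2))
    fun I hI => ?_).trans (by rw [nsmul_eq_mul, numInfosets])
  rw [integral_finsetSum _ fun a ha => X.integrable_sq_deviation hG n hI ha]
  refine (Finset.sum_le_card_nsmul _ _ (n * G.payoffRange p ^ 2)
    fun a ha => X.integral_sq_deviation_le hG n hI ha).trans ?_
  rw [nsmul_eq_mul]
  exact mul_le_mul_of_nonneg_right (Nat.cast_le.2 (card_infosetActions_le hI)) (by positivity)

/-- Cauchy-Schwarz against the constant one. -/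
lemma sum_sqrt_le {ι : Type*} (s : Finset ι) {f : ι → ℝ} (hf : ∀ i ∈ s, 0 ≤ f i) :
    ∑ i ∈ s, √(f i) ≤ √(s.card * ∑ i ∈ s, f i) := by
  refine Real.le_sqrt_of_sq_le ((sq_sum_le_card_mul_sum_sq (s := s)).trans_eq ?_)
  rw [Finset.sum_congr rfl fun i hi => Real.sq_sqrt (hf i hi)]

lemma le_sqrt_sum_sq {ι : Type*} {s : Finset ι} {f : ι → ℝ} {i : ι} (hi : i ∈ s) :
    f i ≤ √(∑ j ∈ s, f j ^ 2) :=
  Real.le_sqrt_of_sq_le (Finset.single_le_sum (f := fun j => f j ^ 2)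
    (fun j _ => sq_nonneg (f j)) hi)

/-- The total regret of a run, in terms of the deviation of the sampled regrets. -/
lemma totalRegret_le_add (hG : G.PerfectRecall) (T : ℕ) (ω : Ω) :
    G.totalRegret p (fun n => X.σ n ω) (T * K) ≤
      G.numInfosets p * √(T * G.maxActions * (K * G.payoffRange p) ^ 2) +
        √(G.numInfosets p * X.totalDeviation (T * K) ω) := by
  -- The true regret is sampled regret plus deviation; at each `I` both are bounded by Euclidean
  -- norms over the actions, uniformly in `a`.
  refine (totalRegret_le hG _ _ (fun I =>
    √(∑ a ∈ G.infosetActions I, max (∑ n ∈ Finset.range (T * K), X.sampled I a n ω) 0 ^ 2) +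
      √(∑ a ∈ G.infosetActions I, X.deviation (T * K) I a ω ^ 2))
    (fun I _ => by positivity) fun I hI a ha => ?_).trans ?_
  · have e : ∑ n ∈ Finset.range (T * K), X.counterfactual I a n ω =
        ∑ n ∈ Finset.range (T * K), X.sampled I a n ω + X.deviation (T * K) I a ω := by
      rw [deviation, Finset.sum_sub_distrib]
      ring
    refine e.trans_le (add_le_add ((le_max_left _ 0).trans ?_) ?_)
    · exact le_sqrt_sum_sq
        (f := fun a => max (∑ n ∈ Finset.range (T * K), X.sampled I a n ω) 0) ha
    · exact le_sqrt_sum_sq (f := fun a => X.deviation (T * K) I a ω) ha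
  · rw [Finset.sum_add_distrib]
    refine add_le_add ?_ (sum_sqrt_le _ fun I _ => Finset.sum_nonneg fun a _ => sq_nonneg _)
    refine (Finset.sum_le_card_nsmul _ _ _ fun I hI => Real.sqrt_le_sqrt
      ((X.sum_sq_max_sampled_le hG hI T ω).trans ?_)).trans_eq (nsmul_eq_mul _ _)
    have := card_infosetActions_le hI
    gcongr

lemma avgRegret_le (hG : G.PerfectRecall) {T : ℕ} (hK : 1 ≤ K) (hT : 1 ≤ T) {ρ : ℝ} (hρ : 0 < ρ)
    {ω : Ω} (hω : X.totalDeviation (T * K) ω ≤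
      G.numInfosets p * (G.maxActions * ((T * K : ℕ) * G.payoffRange p ^ 2)) / ρ) :
    X.avgRegret T ω ≤ (1 + √2 / √(ρ * K)) * G.numInfosets p * G.payoffRange p *
      √(G.maxActions : ℝ) / √(T : ℝ) := by
  have hreg := X.totalRegret_le_add hG T ω
  have hΔ := payoffRange_nonneg G p
  have hK' : (0 : ℝ) < K := by exact_mod_cast hK
  have hT' : (0 : ℝ) < T := by exact_mod_cast hT
  rw [avgRegret]
  set M : ℝ := (G.numInfosets p : ℝ)
  have hM0 : 0 ≤ M := Nat.cast_nonneg _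
  set D := G.payoffRange p
  set A : ℝ := (G.maxActions : ℝ)
  have hA0 : 0 ≤ A := Nat.cast_nonneg _
  set k := √(K : ℝ)
  set t := √(T : ℝ)
  set r := √ρ
  set a := √A
  have hk : 0 < k := Real.sqrt_pos.2 hK'
  have ht : 0 < t := Real.sqrt_pos.2 hT'
  have hr : 0 < r := Real.sqrt_pos.2 hρ
  have ha : 0 ≤ a := Real.sqrt_nonneg _
  have ek : (K : ℝ) = k ^ 2 := (Real.sq_sqrt hK'.le).symm
  have et : (T : ℝ) = t ^ 2 := (Real.sq_sqrt hT'.le).symm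
  have er : ρ = r ^ 2 := (Real.sq_sqrt hρ.le).symm
  have ea : A = a ^ 2 := (Real.sq_sqrt hA0).symm
  have h1 : √(T * A * (K * D) ^ 2) = t * a * (k ^ 2 * D) := by
    rw [ek, et, ea, show t ^ 2 * a ^ 2 * (k ^ 2 * D) ^ 2 = (t * a * (k ^ 2 * D)) ^ 2 by ring]
    exact Real.sqrt_sq (by positivity)
  -- One factor `M` comes from Cauchy-Schwarz and one from the number of summands in
  -- `totalDeviation`, so `M` leaves the root to the first power.
  have h2 : √(M * X.totalDeviation (T * K) ω) ≤ M * a * t * k * D / r := by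
    refine Real.sqrt_le_iff.2 ⟨by positivity, (mul_le_mul_of_nonneg_left hω hM0).trans_eq ?_⟩
    push_cast
    rw [ek, et, ea, er]
    field_simp
  have h3 : √(ρ * K) = r * k := Real.sqrt_mul hρ.le _
  rw [h3]
  calc _ ≤ (M * (t * a * (k ^ 2 * D)) + M * a * t * k * D / r) / (T * K) := by
        refine div_le_div_of_nonneg_right (hreg.trans ?_) (by positivity)
        rw [h1]
        exact add_le_add le_rfl h2
    _ = (1 + 1 / (r * k)) * M * D * a / t := by
        rw [ek, et]
        field_simp
    -- The argument yields the constant `1`; it is only weakened to `√2` here.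
    _ ≤ _ := by
        have : (1 : ℝ) ≤ √2 := Real.one_le_sqrt.2 one_le_two
        gcongr

end KESRun

end Game

end ImperfectInfo

end

theorem theorem4 {Act : Type*} [DecidableEq Act] (G : ImperfectInfo.Game Act) (hG : G.PerfectRecall)
    {Ω : Type*} [MeasurableSpace Ω] (μ : MeasureTheory.Measure Ω)
    [MeasureTheory.IsProbabilityMeasure μ]
    (p : Fin 2) (K T : ℕ) (hK : 1 ≤ K) (hT : 1 ≤ T)
    (X : ImperfectInfo.Game.KESRun G p K μ) (ρ : ℝ) (hρ0 : 0 < ρ) (hρ1 : ρ ≤ 1) :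
    ENNReal.ofReal (1 - ρ) ≤
      μ {ω | X.avgRegret T ω ≤
        (1 + √2 / √(ρ * K)) * G.numInfosets p * G.payoffRange p *
          √(G.maxActions : ℝ) / √(T : ℝ)} := by
  -- One event serves all information sets and actions at once, so no union bound divides `ρ`; on it
  -- the regret bound is deterministic.
  have hMarkov := ImperfectInfo.ofReal_one_sub_le_measure (X.measurable_totalDeviation (T * K))
    (X.integrable_totalDeviation hG (T * K)) (X.totalDeviation_nonneg (T * K))
    (X.integral_totalDeviation_le hG (T * K)) hρ0
  exact hMarkov.trans (MeasureTheory.measure_mono fun ω hω => X.avgRegret_le hG hK hT hρ0 hω)
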